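/- Let $(M,g)$ be a smooth $n$-dimensional Riemannian manifold with Levi-Civita connection $\nabla$ and curvature tensor $R_{X,Y}=[\nabla_X,\nabla_Y]-\nabla_{[X,Y]}$, and let $\mathcal D_1,\mathcal D_2,\mathcal D_3$ be pairwise orthogonal smooth distributions on $M$ of ranks $n_1,n_2,n_3$ with $TM=\mathcal D_1\oplus\mathcal D_2\oplus\mathcal D_3$ (a Riemannian almost 3-product manifold). For a distribution $\mathcal D$ with orthogonal complement $\mathcal D^\perp$ let $$h(X,Y)=\tfrac12(\nabla_XY+\nabla_YX)^\perp,\qquad T(X,Y)=\tfrac12(\nabla_XY-\nabla_YX)^\perp\qquad(X,Y\in\mathcal D)$$ be its second fundamental form and integrability tensor, where $^\perp$ is the projection to $\mathcal D^\perp$, and let $H=\mathrm{tr}_g\,h$ be its mean curvature vector field. Write $h_i,T_i,H_i$ for these objects of $\mathcal D_i$, $h_i^\perp,T_i^\perp,H_i^\perp$ for those of $\mathcal D_i^\perp$, and $$Q_i=\|h_i\|^2+\|h_i^\perp\|^2-\|H_i\|^2-\|H_i^\perp\|^2-\|T_i\|^2-\|T_i^\perp\|^2\qquad(i=1,2,3),$$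 where $\|h_i\|^2=\sum_{a,b}\|h_i(e_a,e_b)\|^2$ over an orthonormal basis $(e_a)$ of $\mathcal D_i$, and similarly for the other tensors. Let $K(u,v)=g(R_{u,v}v,u)$ for orthonormal $u,v$, let $S_{\rm m}(\mathcal D_i,\mathcal D_j)=\sum_{a,b}K(e_a,e'_b)$ for $i\neq j$, where $(e_a)$ and $(e'_b)$ are orthonormal bases of $\mathcal D_i$ and $\mathcal D_j$, and let $S_{\rm mix}(\mathcal D_1,\mathcal D_2,\mathcal D_3)=\sum_{i<j}S_{\rm m}(\mathcal D_i,\mathcal D_j)$. Then, at every point of $M$, $$2\,S_{\rm mix}(\mathcal D_1,\mathcal D_2,\mathcal D_3)=\mathrm{div}(H_1+H_1^\perp+H_2+H_2^\perp+H_3+H_3^\perp)-Q_1-Q_2-Q_3,$$ $$2\,S_{\rm m}(\mathcal D_1,\mathcal D_2)=\mathrm{div}(H_1+H_1^\perp+H_2+H_2^\perp-H_3-H_3^\perp)-Q_1-Q_2+Q_3.$$ -/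

import Mathlib

open Bundle Manifold VectorField Topology
open scoped ContDiff Manifold InnerProductSpace

/-! Riemannian geometry of distributions on a smooth manifold. Throughout, `I` is the model of the
manifold `M`, the metric is the inner product that `RiemannianBundle` puts on the tangent spaces,
and a vector field is a function `X : (x : M) → TangentSpace I x`. -/

namespace AlmostProduct

noncomputable section

variable {E : Type*} [NormedAddCommGroup E] [NormedSpace ℝ E]
  {H : Type*} [TopologicalSpace H] {I : ModelWithCorners ℝ E H}
  {M : Type*} [TopologicalSpace M] [ChartedSpace H M] [IsManifold I 1 M]

/-- A rank-`d` smooth distribution: a field of subspaces of the tangent spaces that is locally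
spanned by `d` pointwise linearly independent smooth vector fields. -/
def IsSmoothDistribution (D : (x : M) → Submodule ℝ (TangentSpace I x)) (d : ℕ) : Prop :=
  ∀ x : M, ∃ U : Set M, IsOpen U ∧ x ∈ U ∧ ∃ X : Fin d → (y : M) → TangentSpace I y,
    (∀ j, ContMDiffOn I I.tangent ∞ (fun y ↦ (⟨y, X j y⟩ : TangentBundle I M)) U) ∧
    ∀ y ∈ U, LinearIndependent ℝ (fun j ↦ X j y) ∧
      Submodule.span ℝ (Set.range fun j ↦ X j y) = D y

/-- A vector field, smooth near `x`, with the value `u` at `x` (constant in the trivialization of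
the tangent bundle at `x`). -/
def vecExt {x : M} (u : TangentSpace I x) : (y : M) → TangentSpace I y :=
  FiberBundle.extend E u

variable [FiniteDimensional ℝ E] [RiemannianBundle (fun x : M ↦ TangentSpace I x)]

instance instFiniteDimensionalTangent (x : M) : FiniteDimensional ℝ (TangentSpace I x) :=
  inferInstanceAs (FiniteDimensional ℝ E)

/-- The right-hand side of the Koszul formula for `2 g(∇_X Y, Z)`. -/
def koszul (X Y Z : (x : M) → TangentSpace I x) (x : M) : ℝ :=
  mvfderiv I (fun y ↦ ⟪Y y, Z y⟫_ℝ) x (X x)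
    + mvfderiv I (fun y ↦ ⟪Z y, X y⟫_ℝ) x (Y x)
    - mvfderiv I (fun y ↦ ⟪X y, Y y⟫_ℝ) x (Z x)
    + ⟪mlieBracket I X Y x, Z x⟫_ℝ
    - ⟪mlieBracket I X Z x, Y x⟫_ℝ
    - ⟪mlieBracket I Y Z x, X x⟫_ℝ

/-- The Levi-Civita connection `∇_X Y`: the vector at `x` whose inner products with an orthonormal
basis of the tangent space are given by the Koszul formula. -/
def nabla (X Y : (x : M) → TangentSpace I x) (x : M) : TangentSpace I x :=
  ∑ i, ((1 / 2 : ℝ) * koszul X Y (vecExt (stdOrthonormalBasis ℝ (TangentSpace I x) i)) x) •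
    stdOrthonormalBasis ℝ (TangentSpace I x) i

/-- The curvature tensor `R_{X,Y} Z = ∇_X ∇_Y Z - ∇_Y ∇_X Z - ∇_{[X,Y]} Z`. -/
def curvature (X Y Z : (x : M) → TangentSpace I x) (x : M) : TangentSpace I x :=
  nabla X (nabla Y Z) x - nabla Y (nabla X Z) x - nabla (mlieBracket I X Y) Z x

/-- `g(R_{u,v} v, u)`, the sectional curvature of the plane spanned by orthonormal `u`, `v`. -/
def sectional {x : M} (u v : TangentSpace I x) : ℝ :=
  ⟪curvature (vecExt u) (vecExt v) (vecExt v) x, u⟫_ℝ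

/-- The divergence of a vector field: the trace of `u ↦ ∇_u X`. -/
def divergence (X : (x : M) → TangentSpace I x) (x : M) : ℝ :=
  ∑ i, ⟪nabla (vecExt (stdOrthonormalBasis ℝ (TangentSpace I x) i)) X x,
    stdOrthonormalBasis ℝ (TangentSpace I x) i⟫_ℝ

/-- The orthogonal complement of a distribution. -/
def perp (D : (x : M) → Submodule ℝ (TangentSpace I x)) (x : M) :
    Submodule ℝ (TangentSpace I x) :=
  (D x)ᗮ

/-- For `u ∈ D x`, a section of `D` with the value `u` at `x`, smooth near `x`: the orthogonal
projection to `D` of a smooth extension of `u`. -/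
def extIn (D : (x : M) → Submodule ℝ (TangentSpace I x)) {x : M} (u : TangentSpace I x) :
    (y : M) → TangentSpace I y :=
  fun y ↦ (D y).starProjection (vecExt u y)

/-- The second fundamental form of `D`, `h(X, Y) = (∇_X Y + ∇_Y X)^⊥ / 2`, on `u, v ∈ D x`. -/
def secondFF (D : (x : M) → Submodule ℝ (TangentSpace I x)) {x : M} (u v : TangentSpace I x) :
    TangentSpace I x :=
  (1 / 2 : ℝ) • (perp D x).starProjection
    (nabla (extIn D u) (extIn D v) x + nabla (extIn D v) (extIn D u) x)

/-- The integrability tensor of `D`, `T(X, Y) = (∇_X Y - ∇_Y X)^⊥ / 2`, on `u, v ∈ D x`. -/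
def integrability (D : (x : M) → Submodule ℝ (TangentSpace I x)) {x : M}
    (u v : TangentSpace I x) : TangentSpace I x :=
  (1 / 2 : ℝ) • (perp D x).starProjection
    (nabla (extIn D u) (extIn D v) x - nabla (extIn D v) (extIn D u) x)

/-- The mean curvature vector field `H = tr h` of `D`. -/
def meanCurvature (D : (x : M) → Submodule ℝ (TangentSpace I x)) (x : M) : TangentSpace I x :=
  ∑ a, secondFF D (stdOrthonormalBasis ℝ (D x) a : TangentSpace I x)
    (stdOrthonormalBasis ℝ (D x) a : TangentSpace I x)

/-- `‖h‖²`, the sum of `‖h(e_a, e_b)‖²` over an orthonormal basis of `D x`. -/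
def normSqSecondFF (D : (x : M) → Submodule ℝ (TangentSpace I x)) (x : M) : ℝ :=
  ∑ a, ∑ b, ‖secondFF D (stdOrthonormalBasis ℝ (D x) a : TangentSpace I x)
    (stdOrthonormalBasis ℝ (D x) b : TangentSpace I x)‖ ^ 2

/-- `‖T‖²`, the sum of `‖T(e_a, e_b)‖²` over an orthonormal basis of `D x`. -/
def normSqIntegrability (D : (x : M) → Submodule ℝ (TangentSpace I x)) (x : M) : ℝ :=
  ∑ a, ∑ b, ‖integrability D (stdOrthonormalBasis ℝ (D x) a : TangentSpace I x)
    (stdOrthonormalBasis ℝ (D x) b : TangentSpace I x)‖ ^ 2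

/-- `Q = ‖h‖² + ‖h^⊥‖² - ‖H‖² - ‖H^⊥‖² - ‖T‖² - ‖T^⊥‖²`. -/
def Q (D : (x : M) → Submodule ℝ (TangentSpace I x)) (x : M) : ℝ :=
  normSqSecondFF D x + normSqSecondFF (perp D) x
    - ‖meanCurvature D x‖ ^ 2 - ‖meanCurvature (perp D) x‖ ^ 2
    - normSqIntegrability D x - normSqIntegrability (perp D) x

/-- The mutual curvature of a pair of orthogonal subspaces of a tangent space: the sum of the
sectional curvatures `K(e_a, e_b)` over orthonormal bases of the two subspaces. -/
def mutualCurvature {x : M} (V W : Submodule ℝ (TangentSpace I x)) : ℝ :=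
  ∑ a, ∑ b, sectional (stdOrthonormalBasis ℝ V a : TangentSpace I x)
    (stdOrthonormalBasis ℝ W b : TangentSpace I x)

/-- The mixed scalar curvature of a triple: the sum of the sectional curvatures `K(e_a, e_b)` over
the planes spanned by two vectors of an adapted orthonormal frame that lie in different
distributions, each plane being counted once. -/
def mixedScalarCurvature (D : Fin 3 → (x : M) → Submodule ℝ (TangentSpace I x)) (x : M) : ℝ :=
  ∑ i, ∑ j, if i < j then mutualCurvature (D i x) (D j x) else 0

/-- Three pairwise orthogonal smooth distributions of ranks `n i` whose sum is the whole tangent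
bundle: the structure of an almost 3-product manifold on a Riemannian manifold. -/
structure IsAlmostThreeProduct (D : Fin 3 → (x : M) → Submodule ℝ (TangentSpace I x))
    (n : Fin 3 → ℕ) : Prop where
  smooth : ∀ i, IsSmoothDistribution (D i) (n i)
  orthogonal : ∀ i j, i ≠ j → ∀ x, D i x ⟂ D j x
  spans : ∀ x, ⨆ i, D i x = ⊤

end

end AlmostProduct

set_option linter.unusedSectionVars false

namespace AlmostProduct

/-! ### The Levi-Civita connection from the Koszul formula -/

section LeviCivita

variable {E : Type*} [NormedAddCommGroup E] [NormedSpace ℝ E] [FiniteDimensional ℝ E]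
  {H : Type*} [TopologicalSpace H] {I : ModelWithCorners ℝ E H}
  {M : Type*} [TopologicalSpace M] [ChartedSpace H M] [IsManifold I ∞ M]
  [RiemannianBundle (fun x : M ↦ TangentSpace I x)]
  [IsContMDiffRiemannianBundle I ∞ E (fun x : M ↦ TangentSpace I x)]
  {X X' Y Y' Z Z' : (x : M) → TangentSpace I x} {f : M → ℝ} {x : M}

/-! Both identities are linear consequences of Walczak's formula for a single distribution `D`: the
mixed curvature of `D` and its orthogonal complement equals `div (H + H^⊥) - Q`
(`IsAdaptedOn.sum_frameSectional`). The complement of `D i` is the sum of the other two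
distributions, so the left side for `D i` is the sum of two mutual curvatures
(`IsAlmostThreeProduct.sum_mutualCurvature`). As mutual curvature is symmetric, adding the three
formulas counts every pair twice, and adding the first two and subtracting the third leaves twice
the mutual curvature of `D 0` and `D 1`.

Walczak's formula is computed in a local orthonormal frame `e` adapted to the distributions, with
connection coefficients `Γ p q r = ⟪∇_{e_p} e_q, e_r⟫`, antisymmetric in `q, r`. Metric
compatibility and vanishing torsion write `K(e_a, e_i)` as `e_a(Γ i i a) + e_i(Γ a a i)` plus terms
quadratic in `Γ` (`frameSectional_eq`). Summed over `a` in `D` and `i` in the complement, the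
derivative terms are exactly those of `div H + div H^⊥`; the quadratic terms agree by index
bookkeeping (`sum_curvature_quadratic_eq`).

The remaining work is to pass to such a frame. Every quantity is defined through pointwise
orthonormal bases and local extensions of vectors, so tensoriality must be proved for the
connection, the curvature and the normal part of the connection on `D`. After that, a trace of a
bilinear form does not depend on the orthonormal basis (`sum_orthonormalBasis_eq`), and the frame
may replace the chosen bases. -/

theorem mdifferentiableAt_inner (hX : MDiffAt (T% X) x) (hY : MDiffAt (T% Y) x) :
    MDiffAt (fun y ↦ ⟪X y, Y y⟫_ℝ) x :=
  MDifferentiableAt.inner_bundle hX hY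

theorem mvfderiv_inner_add_right (hX : MDiffAt (T% X) x) (hY : MDiffAt (T% Y) x)
    (hZ : MDiffAt (T% Z) x) (v : TangentSpace I x) :
    mvfderiv I (fun y ↦ ⟪X y, (Y + Z) y⟫_ℝ) x v =
      mvfderiv I (fun y ↦ ⟪X y, Y y⟫_ℝ) x v + mvfderiv I (fun y ↦ ⟪X y, Z y⟫_ℝ) x v := by
  simp only [Pi.add_apply, inner_add_right]
  rw [mvfderiv_fun_add (mdifferentiableAt_inner hX hY) (mdifferentiableAt_inner hX hZ)]
  rfl

theorem mvfderiv_inner_smul_right (hX : MDiffAt (T% X) x) (hY : MDiffAt (T% Y) x)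
    (hf : MDiffAt f x) (v : TangentSpace I x) :
    mvfderiv I (fun y ↦ ⟪X y, (f • Y) y⟫_ℝ) x v =
      f x * mvfderiv I (fun y ↦ ⟪X y, Y y⟫_ℝ) x v + mvfderiv I f x v * ⟪X x, Y x⟫_ℝ := by
  simp only [Pi.smul_apply', inner_smul_right]
  rw [mvfderiv_fun_mul hf (mdifferentiableAt_inner hX hY)]
  simp [mul_comm]

theorem mvfderiv_congr_of_eventuallyEq {f g : M → ℝ} (h : f =ᶠ[𝓝 x] g) :
    mvfderiv I f x = mvfderiv I g x := by
  simp only [mvfderiv]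
  rw [h.mfderiv_eq, h.self_of_nhds]

theorem koszul_congr_mid (h : Y =ᶠ[𝓝 x] Y') : koszul X Y Z x = koszul X Y' Z x := by
  have h1 : (fun y ↦ ⟪Y y, Z y⟫_ℝ) =ᶠ[𝓝 x] fun y ↦ ⟪Y' y, Z y⟫_ℝ := h.mono fun y hy ↦ by simp [hy]
  have h2 : (fun y ↦ ⟪X y, Y y⟫_ℝ) =ᶠ[𝓝 x] fun y ↦ ⟪X y, Y' y⟫_ℝ := h.mono fun y hy ↦ by simp [hy]
  simp only [koszul, mvfderiv_congr_of_eventuallyEq h1, mvfderiv_congr_of_eventuallyEq h2,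
    h.self_of_nhds,
    Filter.EventuallyEq.mlieBracket_vectorField_eq (Filter.EventuallyEq.refl _ X) h,
    Filter.EventuallyEq.mlieBracket_vectorField_eq h (Filter.EventuallyEq.refl _ Z)]

/-- The Koszul expression is determined by metric compatibility in its last two arguments. -/
theorem koszul_eq_sub_swap_right :
    koszul X Y Z x = 2 * mvfderiv I (fun y ↦ ⟪Y y, Z y⟫_ℝ) x (X x) - koszul X Z Y x := by
  have e (U V : (x : M) → TangentSpace I x) : (fun y ↦ ⟪U y, V y⟫_ℝ) = fun y ↦ ⟪V y, U y⟫_ℝ := by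
    ext y; exact real_inner_comm _ _
  have hb : mlieBracket I Z Y x = - mlieBracket I Y Z x := mlieBracket_swap_apply
  simp only [koszul, e Z X, e Y X, e Z Y, hb, inner_neg_left]
  ring

/-- Combined with `koszul_eq_sub_swap_right` this gives vanishing torsion. It also moves `X` to the
last slot, so that behaviour in the first slot reduces to tensoriality in the last one. -/
theorem koszul_eq_sub_rotate :
    koszul X Y Z x = 2 * ⟪mlieBracket I X Y x, Z x⟫_ℝ
      + 2 * mvfderiv I (fun y ↦ ⟪Z y, X y⟫_ℝ) x (Y x) - koszul Y Z X x := by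
  have hb : mlieBracket I Y X x = - mlieBracket I X Y x := mlieBracket_swap_apply
  have hb' : mlieBracket I Z X x = - mlieBracket I X Z x := mlieBracket_swap_apply
  simp only [koszul, hb, hb', inner_neg_left]
  ring

theorem koszul_tensorialAt_right (hX : MDiffAt (T% X) x) (hY : MDiffAt (T% Y) x) :
    TensorialAt I E (fun Z : (x : M) → TangentSpace I x ↦ koszul X Y Z x) x where
  smul {f Z} hf hZ := by
    have e1 : (fun y ↦ ⟪(f • Z) y, X y⟫_ℝ) = fun y ↦ ⟪X y, (f • Z) y⟫_ℝ := by
      ext y; exact real_inner_comm _ _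
    have e2 : (fun y ↦ ⟪Z y, X y⟫_ℝ) = fun y ↦ ⟪X y, Z y⟫_ℝ := by
      ext y; exact real_inner_comm _ _
    simp only [koszul, e1, e2]
    rw [mvfderiv_inner_smul_right hY hZ hf, mvfderiv_inner_smul_right hX hZ hf,
      mlieBracket_smul_right hf hZ, mlieBracket_smul_right hf hZ]
    simp only [Pi.smul_apply', inner_add_left, inner_smul_left, inner_smul_right, map_smul,
      smul_eq_mul, real_inner_comm, conj_trivial]
    ring
  add {Z Z'} hZ hZ' := by
    have e (Z : (x : M) → TangentSpace I x) :
      (fun y ↦ ⟪Z y, X y⟫_ℝ) = fun y ↦ ⟪X y, Z y⟫_ℝ := by ext y; exact real_inner_comm _ _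
    simp only [koszul, e]
    rw [mvfderiv_inner_add_right hY hZ hZ', mvfderiv_inner_add_right hX hZ hZ',
      mlieBracket_add_right hZ hZ', mlieBracket_add_right hZ hZ']
    simp only [Pi.add_apply, inner_add_left, inner_add_right, map_add]
    ring

theorem mdifferentiableAt_vecExt (u : TangentSpace I x) : MDiffAt (T% (vecExt u)) x :=
  FiberBundle.mdifferentiableAt_extend I E u

@[simp]
theorem vecExt_self (u : TangentSpace I x) : vecExt u x = u :=
  FiberBundle.extend_apply_self E u

/-- The definition of `nabla` tests the Koszul expression only on extensions of one orthonormal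
basis; tensoriality in the last slot makes it valid for every differentiable `Z`. -/
theorem inner_nabla (hX : MDiffAt (T% X) x) (hY : MDiffAt (T% Y) x) (hZ : MDiffAt (T% Z) x) :
    ⟪nabla X Y x, Z x⟫_ℝ = 1 / 2 * koszul X Y Z x := by
  have hT := koszul_tensorialAt_right hX hY
  set φ := TensorialAt.mkHom _ x hT with hφ
  have hφs : ∀ u : TangentSpace I x, koszul X Y (vecExt u) x = φ u := fun u ↦
    (TensorialAt.mkHom_apply_eq_extend hT u).symm
  have hZ' : koszul X Y Z x = φ (Z x) := (TensorialAt.mkHom_apply hT hZ).symm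
  rw [hZ', nabla]
  simp only [hφs]
  conv_rhs => rw [← (stdOrthonormalBasis ℝ (TangentSpace I x)).sum_repr' (Z x)]
  rw [sum_inner, map_sum, Finset.mul_sum]
  refine Finset.sum_congr rfl fun i _ ↦ ?_
  rw [inner_smul_left, map_smul, smul_eq_mul, conj_trivial]
  ring

theorem nabla_congr_right (h : Y =ᶠ[𝓝 x] Y') : nabla X Y x = nabla X Y' x := by
  simp only [nabla, koszul_congr_mid h]

theorem eq_of_inner_vecExt {u v : TangentSpace I x}
    (h : ∀ w : TangentSpace I x, ⟪u, vecExt w x⟫_ℝ = ⟪v, vecExt w x⟫_ℝ) : u = v :=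
  ext_inner_right ℝ fun w ↦ by simpa using h w

/-- Metric compatibility of the Levi-Civita connection. -/
theorem mvfderiv_inner (hX : MDiffAt (T% X) x) (hY : MDiffAt (T% Y) x) (hZ : MDiffAt (T% Z) x) :
    mvfderiv I (fun y ↦ ⟪Y y, Z y⟫_ℝ) x (X x) = ⟪nabla X Y x, Z x⟫_ℝ + ⟪Y x, nabla X Z x⟫_ℝ := by
  rw [real_inner_comm _ (Y x), inner_nabla hX hY hZ, inner_nabla hX hZ hY,
    koszul_eq_sub_swap_right (Y := Y)]
  ring

/-- The Levi-Civita connection is torsion-free. -/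
theorem nabla_sub_nabla (hX : MDiffAt (T% X) x) (hY : MDiffAt (T% Y) x) :
    nabla X Y x - nabla Y X x = mlieBracket I X Y x := by
  refine eq_of_inner_vecExt fun w ↦ ?_
  have hw := mdifferentiableAt_vecExt w
  rw [inner_sub_left, inner_nabla hX hY hw, inner_nabla hY hX hw,
    koszul_eq_sub_rotate (X := X), koszul_eq_sub_swap_right (X := Y) (Y := X)]
  have e : (fun y ↦ ⟪vecExt w y, X y⟫_ℝ) = fun y ↦ ⟪X y, vecExt w y⟫_ℝ := by
    ext y; exact real_inner_comm _ _
  rw [e]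
  ring

theorem nabla_add_right (hX : MDiffAt (T% X) x) (hY : MDiffAt (T% Y) x) (hY' : MDiffAt (T% Y') x) :
    nabla X (Y + Y') x = nabla X Y x + nabla X Y' x := by
  refine eq_of_inner_vecExt fun w ↦ ?_
  have hw := mdifferentiableAt_vecExt w
  have e (Y : (x : M) → TangentSpace I x) :
      (fun y ↦ ⟪Y y, vecExt w y⟫_ℝ) = fun y ↦ ⟪vecExt w y, Y y⟫_ℝ := by
    ext y; exact real_inner_comm _ _
  rw [inner_add_left, inner_nabla hX (mdifferentiableAt_add_section hY hY') hw,
    inner_nabla hX hY hw, inner_nabla hX hY' hw, koszul_eq_sub_swap_right,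
    koszul_eq_sub_swap_right (Y := Y), koszul_eq_sub_swap_right (Y := Y'), e, e, e,
    mvfderiv_inner_add_right hw hY hY', (koszul_tensorialAt_right hX hw).add hY hY']
  ring

theorem nabla_smul_right (hX : MDiffAt (T% X) x) (hY : MDiffAt (T% Y) x) (hf : MDiffAt f x) :
    nabla X (f • Y) x = f x • nabla X Y x + mvfderiv I f x (X x) • Y x := by
  refine eq_of_inner_vecExt fun w ↦ ?_
  have hw := mdifferentiableAt_vecExt w
  have e (Y : (x : M) → TangentSpace I x) :
      (fun y ↦ ⟪Y y, vecExt w y⟫_ℝ) = fun y ↦ ⟪vecExt w y, Y y⟫_ℝ := by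
    ext y; exact real_inner_comm _ _
  rw [inner_add_left, inner_smul_left, inner_smul_left, inner_nabla hX (hf.smul_section hY) hw,
    inner_nabla hX hY hw, koszul_eq_sub_swap_right,
    koszul_eq_sub_swap_right (Y := Y), e, e,
    mvfderiv_inner_smul_right hw hY hf, (koszul_tensorialAt_right hX hw).smul hf hY,
    real_inner_comm (Y x)]
  simp only [conj_trivial]
  ring

/-- Rotating puts `X` in the last, tensorial slot; the derivatives of `f` coming from the bracket
and from the inner product cancel. -/
theorem nabla_tensorialAt_left (hY : MDiffAt (T% Y) x) :
    TensorialAt I E (fun X : (x : M) → TangentSpace I x ↦ nabla X Y x) x where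
  smul {f X} hf hX := by
    refine eq_of_inner_vecExt fun w ↦ ?_
    have hw := mdifferentiableAt_vecExt w
    rw [inner_smul_left, inner_nabla (hf.smul_section hX) hY hw, inner_nabla hX hY hw,
      koszul_eq_sub_rotate, koszul_eq_sub_rotate (X := X), (koszul_tensorialAt_right hY hw).smul hf hX,
      mvfderiv_inner_smul_right hw hX hf, mlieBracket_smul_left hf hX, inner_add_left,
      inner_smul_left, inner_smul_left, real_inner_comm (X x)]
    simp only [conj_trivial]
    ring
  add {X X'} hX hX' := by
    refine eq_of_inner_vecExt fun w ↦ ?_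
    have hw := mdifferentiableAt_vecExt w
    rw [inner_add_left, inner_nabla (mdifferentiableAt_add_section hX hX') hY hw,
      inner_nabla hX hY hw, inner_nabla hX' hY hw, koszul_eq_sub_rotate,
      koszul_eq_sub_rotate (X := X), koszul_eq_sub_rotate (X := X'),
      (koszul_tensorialAt_right hY hw).add hX hX',
      mvfderiv_inner_add_right hw hX hX', mlieBracket_add_left hX hX', inner_add_left]
    ring

/-- The covariant derivative of `Y` at `x`, as a linear map on the tangent space. -/
noncomputable def covDeriv (Y : (x : M) → TangentSpace I x) (x : M) (hY : MDiffAt (T% Y) x) :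
    TangentSpace I x →L[ℝ] TangentSpace I x :=
  TensorialAt.mkHom (fun X : (x : M) → TangentSpace I x ↦ nabla X Y x) x
    (nabla_tensorialAt_left hY)

theorem covDeriv_apply (hX : MDiffAt (T% X) x) (hY : MDiffAt (T% Y) x) :
    covDeriv Y x hY (X x) = nabla X Y x :=
  TensorialAt.mkHom_apply (nabla_tensorialAt_left hY) hX

end LeviCivita
-- Smooth fields on open sets, derivations and orthonormal frames
section Frames

variable {E : Type*} [NormedAddCommGroup E] [NormedSpace ℝ E] [FiniteDimensional ℝ E]
  {H : Type*} [TopologicalSpace H] {I : ModelWithCorners ℝ E H}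
  {M : Type*} [TopologicalSpace M] [ChartedSpace H M] [IsManifold I ∞ M]
  [RiemannianBundle (fun x : M ↦ TangentSpace I x)]
  [IsContMDiffRiemannianBundle I ∞ E (fun x : M ↦ TangentSpace I x)]
  {X X' Y Y' Z Z' : (x : M) → TangentSpace I x} {f g : M → ℝ} {x : M} {U : Set M}

/-- Smoothness of a vector field on a set. -/
def SmoothFieldOn (U : Set M) (X : (x : M) → TangentSpace I x) : Prop :=
  ContMDiffOn I I.tangent ∞ (fun y ↦ (⟨y, X y⟩ : TangentBundle I M)) U

theorem SmoothFieldOn.mono {V : Set M} (h : SmoothFieldOn U X) (hV : V ⊆ U) :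
    SmoothFieldOn V X := ContMDiffOn.mono h hV

theorem SmoothFieldOn.contMDiffAt (h : SmoothFieldOn U X) (hU : IsOpen U) (hx : x ∈ U) :
    ContMDiffAt I I.tangent ∞ (fun y ↦ (⟨y, X y⟩ : TangentBundle I M)) x :=
  ContMDiffOn.contMDiffAt h (hU.mem_nhds hx)

theorem SmoothFieldOn.mdiffAt (h : SmoothFieldOn U X) (hU : IsOpen U) (hx : x ∈ U) :
    MDiffAt (T% X) x :=
  (h.contMDiffAt hU hx).mdifferentiableAt (by simp)

theorem SmoothFieldOn.add (hX : SmoothFieldOn U X) (hY : SmoothFieldOn U Y) :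
    SmoothFieldOn U (X + Y) := ContMDiffOn.add_section hX hY

theorem SmoothFieldOn.sub (hX : SmoothFieldOn U X) (hY : SmoothFieldOn U Y) :
    SmoothFieldOn U (X - Y) := ContMDiffOn.sub_section hX hY

theorem SmoothFieldOn.smul (hf : ContMDiffOn I 𝓘(ℝ, ℝ) ∞ f U) (hX : SmoothFieldOn U X) :
    SmoothFieldOn U (f • X) := ContMDiffOn.smul_section hf hX

theorem SmoothFieldOn.sum {ι : Type*} {s : Finset ι} {X : ι → (x : M) → TangentSpace I x}
    (h : ∀ i ∈ s, SmoothFieldOn U (X i)) : SmoothFieldOn U (fun y ↦ ∑ i ∈ s, X i y) :=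
  ContMDiffOn.sum_section h

theorem SmoothFieldOn.congr (hX : SmoothFieldOn U X) (h : ∀ y ∈ U, Y y = X y) :
    SmoothFieldOn U Y :=
  ContMDiffOn.congr hX fun y hy ↦ by rw [h y hy]

theorem SmoothFieldOn.inner (hX : SmoothFieldOn U X) (hY : SmoothFieldOn U Y) :
    ContMDiffOn I 𝓘(ℝ, ℝ) ∞ (fun y ↦ ⟪X y, Y y⟫_ℝ) U :=
  ContMDiffOn.inner_bundle hX hY

theorem mdiffAt_of_contMDiffOn (hf : ContMDiffOn I 𝓘(ℝ, ℝ) ∞ f U) (hU : IsOpen U) (hx : x ∈ U) :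
    MDiffAt f x :=
  (hf.contMDiffAt (hU.mem_nhds hx)).mdifferentiableAt (by simp)

theorem SmoothFieldOn.mlieBracket (hX : SmoothFieldOn U X) (hY : SmoothFieldOn U Y)
    (hU : IsOpen U) : SmoothFieldOn U (mlieBracket I X Y) := by
  intro y hy
  -- The bracket loses one derivative, which is harmless because `∞ + 1 = ∞`.
  have : IsManifold I (((⊤ : ℕ∞) : ℕ∞ω) + 1) M := by
    have : (((⊤ : ℕ∞) : ℕ∞ω) + 1) = ∞ := rfl
    rw [this]; infer_instance
  have : IsManifold I (minSmoothness ℝ 2) M := by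
    rw [minSmoothness_of_isRCLikeNormedField]; infer_instance
  refine ContMDiffAt.contMDiffWithinAt ?_
  exact ContMDiffAt.mlieBracket_vectorField (n := ⊤) (m := ⊤) (hX.contMDiffAt hU hy)
    (hY.contMDiffAt hU hy) (by simp)

/-- The derivative of `f` along `X` is the fibre coordinate of the tangent map of `f` composed with
the section `X`. -/
theorem SmoothFieldOn.mvfderiv_apply (hX : SmoothFieldOn U X)
    (hf : ContMDiffOn I 𝓘(ℝ, ℝ) ∞ f U) (hU : IsOpen U) :
    ContMDiffOn I 𝓘(ℝ, ℝ) ∞ (fun y ↦ mvfderiv I f y (X y)) U := by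
  have h1 := hf.contMDiffOn_tangentMapWithin (m := ∞) (by simp) hU.uniqueMDiffOn
  have h2 := h1.comp hX (fun y hy ↦ hy)
  have h3 := (contMDiff_snd_tangentBundle_modelSpace (n := ∞) ℝ 𝓘(ℝ, ℝ)).comp_contMDiffOn h2
  refine h3.congr fun y hy ↦ ?_
  simp only [Function.comp, tangentMapWithin, mfderivWithin_of_isOpen hU hy]
  rfl

theorem exists_smoothFieldOn_vecExt (u : TangentSpace I x) :
    ∃ V : Set M, IsOpen V ∧ x ∈ V ∧ SmoothFieldOn V (vecExt u) := by
  obtain ⟨s, hs, h⟩ := FiberBundle.exists_contMDiffOn_extend (k := ∞) I E u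
  obtain ⟨V, hVs, hV, hx⟩ := mem_nhds_iff.1 hs
  exact ⟨V, hV, hx, h.mono hVs⟩

/-- Vector fields act on functions by the commutator, up to a vector multiple. -/
theorem mvfderiv_commutator_smul (hX : SmoothFieldOn U X) (hY : SmoothFieldOn U Y)
    (hZ : SmoothFieldOn U Z) (hf : ContMDiffOn I 𝓘(ℝ, ℝ) ∞ f U) (hU : IsOpen U) (hx : x ∈ U) :
    (mvfderiv I (fun y ↦ mvfderiv I f y (Y y)) x (X x)
      - mvfderiv I (fun y ↦ mvfderiv I f y (X y)) x (Y x)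
      - mvfderiv I f x (mlieBracket I X Y x)) • Z x = 0 := by
  -- Leibniz rule applied twice. The two mixed first-order terms are symmetric in `X` and `Y`, so
  -- they cancel when the Jacobi identity for `X, Y, f • Z` is compared with `f` times the one for
  -- `X, Y, Z`; only second derivatives of `f` and the bracket term survive.
  have key (X Y : (x : M) → TangentSpace I x) (hX : SmoothFieldOn U X) (hY : SmoothFieldOn U Y) :
      mlieBracket I X (mlieBracket I Y (f • Z)) x =
        mvfderiv I (fun y ↦ mvfderiv I f y (Y y)) x (X x) • Z x
        + mvfderiv I f x (Y x) • mlieBracket I X Z x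
        + mvfderiv I f x (X x) • mlieBracket I Y Z x
        + f x • mlieBracket I X (mlieBracket I Y Z) x := by
    have e : mlieBracket I Y (f • Z) =ᶠ[𝓝 x]
        (fun y ↦ mvfderiv I f y (Y y)) • Z + f • mlieBracket I Y Z := by
      filter_upwards [hU.mem_nhds hx] with y hy
      exact mlieBracket_smul_right (mdiffAt_of_contMDiffOn hf hU hy) (hZ.mdiffAt hU hy)
    have hYf := hY.mvfderiv_apply hf hU
    have hYZ := hY.mlieBracket hZ hU
    rw [Filter.EventuallyEq.mlieBracket_vectorField_eq (Filter.EventuallyEq.refl _ X) e,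
      mlieBracket_add_right ((SmoothFieldOn.smul hYf hZ).mdiffAt hU hx)
        ((SmoothFieldOn.smul hf hYZ).mdiffAt hU hx),
      mlieBracket_smul_right (mdiffAt_of_contMDiffOn hYf hU hx) (hZ.mdiffAt hU hx),
      mlieBracket_smul_right (mdiffAt_of_contMDiffOn hf hU hx) (hYZ.mdiffAt hU hx)]
    abel
  have : IsManifold I (minSmoothness ℝ 3) M := by
    rw [minSmoothness_of_isRCLikeNormedField]; infer_instance
  have c (X : (x : M) → TangentSpace I x) (hX : SmoothFieldOn U X) :
      ContMDiffAt I I.tangent (minSmoothness ℝ 2) (fun y ↦ (⟨y, X y⟩ : TangentBundle I M)) x := by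
    rw [minSmoothness_of_isRCLikeNormedField]
    exact (hX.contMDiffAt hU hx).of_le ENat.LEInfty.out
  have J := leibniz_identity_mlieBracket_apply (c X hX) (c Y hY) (c _ (SmoothFieldOn.smul hf hZ))
  have J' := leibniz_identity_mlieBracket_apply (c X hX) (c Y hY) (c Z hZ)
  rw [key X Y hX hY, key Y X hY hX, mlieBracket_smul_right (mdiffAt_of_contMDiffOn hf hU hx)
    (hZ.mdiffAt hU hx), J'] at J
  rw [← sub_eq_zero] at J
  refine Eq.trans ?_ J
  simp only [sub_smul, smul_add]
  abel

/-- An orthonormal frame of the tangent bundle, smooth on the open set `U`. -/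
structure IsOrthonormalFrameOn {ι : Type*} (e : ι → (x : M) → TangentSpace I x) (U : Set M) :
    Prop where
  isOpen : IsOpen U
  smooth : ∀ p, SmoothFieldOn U (e p)
  orthonormal : ∀ y ∈ U, Orthonormal ℝ fun p ↦ e p y
  span : ∀ y ∈ U, ⊤ ≤ Submodule.span ℝ (Set.range fun p ↦ e p y)

namespace IsOrthonormalFrameOn

variable {ι : Type*} [Fintype ι] {e : ι → (x : M) → TangentSpace I x}

theorem mono {V : Set M} (h : IsOrthonormalFrameOn e U) (hV : IsOpen V) (hVU : V ⊆ U) :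
    IsOrthonormalFrameOn e V :=
  ⟨hV, fun p ↦ (h.smooth p).mono hVU, fun y hy ↦ h.orthonormal y (hVU hy),
    fun y hy ↦ h.span y (hVU hy)⟩

/-- The orthonormal basis given by a frame at a point. -/
noncomputable def basis (h : IsOrthonormalFrameOn e U) (hx : x ∈ U) :
    OrthonormalBasis ι ℝ (TangentSpace I x) :=
  OrthonormalBasis.mk (h.orthonormal x hx) (h.span x hx)

@[simp]
theorem basis_apply (h : IsOrthonormalFrameOn e U) (hx : x ∈ U) (p : ι) : h.basis hx p = e p x := by
  simp [basis]

theorem sum_inner_smul (h : IsOrthonormalFrameOn e U) (hx : x ∈ U) (v : TangentSpace I x) :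
    ∑ p, ⟪e p x, v⟫_ℝ • e p x = v := by
  simpa using (h.basis hx).sum_repr' v

theorem sum_inner_mul_inner (h : IsOrthonormalFrameOn e U) (hx : x ∈ U)
    (v w : TangentSpace I x) : ∑ p, ⟪v, e p x⟫_ℝ * ⟪w, e p x⟫_ℝ = ⟪v, w⟫_ℝ := by
  have := (h.basis hx).sum_inner_mul_inner v w
  simpa [real_inner_comm] using this

/-- The pointwise bases in the definition of `nabla` need not vary smoothly, so smoothness is read
off from the coefficients in the smooth frame, which are Koszul expressions. -/
theorem smooth_nabla (h : IsOrthonormalFrameOn e U) (hX : SmoothFieldOn U X)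
    (hY : SmoothFieldOn U Y) : SmoothFieldOn U (nabla X Y) := by
  have hU := h.isOpen
  have hk (p) : ContMDiffOn I 𝓘(ℝ, ℝ) ∞ (fun y ↦ (1 / 2 : ℝ) * koszul X Y (e p) y) U := by
    have he := h.smooth p
    refine contMDiffOn_const.mul ?_
    exact ((((((hX.mvfderiv_apply (hY.inner he) hU).add
      (hY.mvfderiv_apply (he.inner hX) hU))).sub (he.mvfderiv_apply (hX.inner hY) hU)).add
      ((hX.mlieBracket hY hU).inner he)).sub ((hX.mlieBracket he hU).inner hY)).sub
      ((hY.mlieBracket he hU).inner hX)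
  refine (SmoothFieldOn.sum (s := Finset.univ)
    fun p _ ↦ SmoothFieldOn.smul (hk p) (h.smooth p)).congr fun y hy ↦ ?_
  rw [← h.sum_inner_smul hy (nabla X Y y)]
  refine Finset.sum_congr rfl fun p _ ↦ ?_
  rw [real_inner_comm, inner_nabla (hX.mdiffAt hU hy) (hY.mdiffAt hU hy)
    ((h.smooth p).mdiffAt hU hy)]
  rfl

end IsOrthonormalFrameOn

end Frames
-- Tensoriality of the curvature
section Curvature

variable {E : Type*} [NormedAddCommGroup E] [NormedSpace ℝ E] [FiniteDimensional ℝ E]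
  {H : Type*} [TopologicalSpace H] {I : ModelWithCorners ℝ E H}
  {M : Type*} [TopologicalSpace M] [ChartedSpace H M] [IsManifold I ∞ M]
  [RiemannianBundle (fun x : M ↦ TangentSpace I x)]
  [IsContMDiffRiemannianBundle I ∞ E (fun x : M ↦ TangentSpace I x)]
  {X X' Y Y' Z Z' : (x : M) → TangentSpace I x} {f g : M → ℝ} {x : M} {U : Set M}
  {ι : Type*} [Fintype ι] {e : ι → (x : M) → TangentSpace I x}

/-- An operation on vector fields that is linear at `x` over the functions smooth on `U`, when
applied to fields smooth on `U`. -/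
structure TensorialOn {A : Type*} [AddCommGroup A] [Module ℝ A] (U : Set M) (x : M)
    (Φ : ((x : M) → TangentSpace I x) → A) : Prop where
  smul : ∀ {f : M → ℝ} {X : (x : M) → TangentSpace I x}, ContMDiffOn I 𝓘(ℝ, ℝ) ∞ f U →
    SmoothFieldOn U X → Φ (f • X) = f x • Φ X
  add : ∀ {X X' : (x : M) → TangentSpace I x}, SmoothFieldOn U X → SmoothFieldOn U X' →
    Φ (X + X') = Φ X + Φ X'

namespace TensorialOn

variable {A : Type*} [AddCommGroup A] [Module ℝ A] {Φ : ((x : M) → TangentSpace I x) → A}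

/-- Smoothness is required on `U` only, so the indicator of `U` is an admissible multiplier: it
equals `1` at `x` and erases any difference between the fields outside `U`. No bump function is
needed. -/
theorem congr (hΦ : TensorialOn U x Φ) (hx : x ∈ U) (hX : SmoothFieldOn U X)
    (h : ∀ y ∈ U, X' y = X y) : Φ X = Φ X' := by
  classical
  have hX' : SmoothFieldOn U X' := hX.congr h
  let ψ : M → ℝ := U.indicator 1
  have hψ : ContMDiffOn I 𝓘(ℝ, ℝ) ∞ ψ U :=
    (contMDiffOn_const (c := (1 : ℝ))).congr fun y hy ↦ by simp [ψ, hy]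
  have hψx : ψ x = 1 := by simp [ψ, hx]
  have e : ψ • X = ψ • X' := by
    ext1 y
    by_cases hy : y ∈ U
    · simp [h y hy]
    · simp [ψ, hy]
  calc Φ X = Φ (ψ • X) := by rw [hΦ.smul hψ hX, hψx, one_smul]
    _ = Φ (ψ • X') := by rw [e]
    _ = Φ X' := by rw [hΦ.smul hψ hX', hψx, one_smul]

theorem map_zero (hΦ : TensorialOn U x Φ) : Φ 0 = 0 := by
  have h0 : SmoothFieldOn U (0 : (x : M) → TangentSpace I x) :=
    (Bundle.contMDiff_zeroSection ℝ (TangentSpace I : M → Type _)).contMDiffOn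
  have := hΦ.add h0 h0
  simpa using this

theorem map_sum (hΦ : TensorialOn U x Φ) {κ : Type*} {X : κ → (x : M) → TangentSpace I x}
    (s : Finset κ) (h : ∀ i ∈ s, SmoothFieldOn U (X i)) :
    Φ (fun y ↦ ∑ i ∈ s, X i y) = ∑ i ∈ s, Φ (X i) := by
  classical
  induction s using Finset.induction_on with
  | empty =>
    simp only [Finset.sum_empty]
    exact hΦ.map_zero
  | insert a s ha ih =>
    simp only [Finset.mem_insert, forall_eq_or_imp] at h
    simp only [Finset.sum_insert ha, ← ih h.2]
    exact hΦ.add h.1 (SmoothFieldOn.sum h.2)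

theorem eq_sum_frame (hΦ : TensorialOn U x Φ) (h : IsOrthonormalFrameOn e U) (hx : x ∈ U)
    (hX : SmoothFieldOn U X) : Φ X = ∑ p, ⟪e p x, X x⟫_ℝ • Φ (e p) := by
  have hc (p) : ContMDiffOn I 𝓘(ℝ, ℝ) ∞ (fun y ↦ ⟪e p y, X y⟫_ℝ) U := (h.smooth p).inner hX
  have hs := hΦ.map_sum Finset.univ (X := fun p ↦ (fun y ↦ ⟪e p y, X y⟫_ℝ) • e p)
    fun p _ ↦ SmoothFieldOn.smul (hc p) (h.smooth p)
  rw [hΦ.congr hx hX (X' := fun y ↦ ∑ p, ((fun y ↦ ⟪e p y, X y⟫_ℝ) • e p) y)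
    fun y hy ↦ h.sum_inner_smul hy (X y), hs]
  exact Finset.sum_congr rfl fun p _ ↦ hΦ.smul (hc p) (h.smooth p)

end TensorialOn

theorem curvature_swap (hX : SmoothFieldOn U X) (hY : SmoothFieldOn U Y) (hZ : SmoothFieldOn U Z)
    (hU : IsOpen U) (hx : x ∈ U) : curvature X Y Z x = - curvature Y X Z x := by
  have hXY := (hX.mlieBracket hY hU).mdiffAt hU hx
  have hYX := (hY.mlieBracket hX hU).mdiffAt hU hx
  have hb : mlieBracket I X Y x = - mlieBracket I Y X x := mlieBracket_swap_apply
  have hZx := hZ.mdiffAt hU hx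
  -- The direction of differentiation enters only through its value at `x`, so antisymmetry of the
  -- bracket at that point suffices.
  have : nabla (mlieBracket I X Y) Z x = - nabla (mlieBracket I Y X) Z x := by
    rw [← covDeriv_apply hXY hZx, ← covDeriv_apply hYX hZx, hb, map_neg]
  rw [curvature, curvature, this]
  abel

/-- The term `-(Y f) ∇_X Z` from `∇_Y (f ∇_X Z)` cancels against the one from `[f X, Y] = f [X, Y] -
(Y f) X`. -/
theorem curvature_tensorialOn_left (h : IsOrthonormalFrameOn e U) (hx : x ∈ U)
    (hY : SmoothFieldOn U Y) (hZ : SmoothFieldOn U Z) :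
    TensorialOn U x fun X ↦ curvature X Y Z x where
  smul {f X} hf hX := by
    have hU := h.isOpen
    have m {X : (x : M) → TangentSpace I x} (hX : SmoothFieldOn U X) {y : M} (hy : y ∈ U) :
      MDiffAt (T% X) y := hX.mdiffAt hU hy
    have hfx {y : M} (hy : y ∈ U) := mdiffAt_of_contMDiffOn hf hU hy
    have hfX := SmoothFieldOn.smul hf hX
    have e1 : nabla (f • X) Z =ᶠ[𝓝 x] f • nabla X Z := by
      filter_upwards [hU.mem_nhds hx] with y hy
      exact (nabla_tensorialAt_left (m hZ hy)).smul (hfx hy) (m hX hy)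
    have hb := mlieBracket_smul_left (W := Y) (hfx hx) (m hX hx)
    have e2 : nabla (mlieBracket I (f • X) Y) Z x
        = - mvfderiv I f x (Y x) • nabla X Z x + f x • nabla (mlieBracket I X Y) Z x := by
      rw [← covDeriv_apply (m (hfX.mlieBracket hY hU) hx) (m hZ hx), hb, map_add, map_smul,
        map_smul, covDeriv_apply (m hX hx), covDeriv_apply (m (hX.mlieBracket hY hU) hx)]
    rw [curvature, (nabla_tensorialAt_left (m (h.smooth_nabla hY hZ) hx)).smul (hfx hx) (m hX hx),
      nabla_congr_right e1, nabla_smul_right (m hY hx) (m (h.smooth_nabla hX hZ) hx) (hfx hx), e2,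
      curvature]
    simp only [smul_sub, neg_smul]
    abel
  add {X X'} hX hX' := by
    have hU := h.isOpen
    have m {X : (x : M) → TangentSpace I x} (hX : SmoothFieldOn U X) {y : M} (hy : y ∈ U) :
      MDiffAt (T% X) y := hX.mdiffAt hU hy
    have e1 : nabla (X + X') Z =ᶠ[𝓝 x] nabla X Z + nabla X' Z := by
      filter_upwards [hU.mem_nhds hx] with y hy
      exact (nabla_tensorialAt_left (m hZ hy)).add (m hX hy) (m hX' hy)
    have hb := mlieBracket_add_left (W := Y) (m hX hx) (m hX' hx)
    have e2 : nabla (mlieBracket I (X + X') Y) Z x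
        = nabla (mlieBracket I X Y) Z x + nabla (mlieBracket I X' Y) Z x := by
      rw [← covDeriv_apply (m ((hX.add hX').mlieBracket hY hU) hx) (m hZ hx), hb, map_add,
        covDeriv_apply (m (hX.mlieBracket hY hU) hx), covDeriv_apply (m (hX'.mlieBracket hY hU) hx)]
    rw [curvature, (nabla_tensorialAt_left (m (h.smooth_nabla hY hZ) hx)).add (m hX hx) (m hX' hx),
      nabla_congr_right e1, nabla_add_right (m hY hx) (m (h.smooth_nabla hX hZ) hx)
      (m (h.smooth_nabla hX' hZ) hx), e2, curvature, curvature]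
    abel

theorem curvature_tensorialOn_mid (h : IsOrthonormalFrameOn e U) (hx : x ∈ U)
    (hX : SmoothFieldOn U X) (hZ : SmoothFieldOn U Z) :
    TensorialOn U x fun Y ↦ curvature X Y Z x where
  smul {f Y} hf hY := by
    rw [curvature_swap hX (SmoothFieldOn.smul hf hY) hZ h.isOpen hx,
      (curvature_tensorialOn_left h hx hX hZ).smul hf hY, curvature_swap hX hY hZ h.isOpen hx,
      smul_neg]
  add {Y Y'} hY hY' := by
    rw [curvature_swap hX (hY.add hY') hZ h.isOpen hx,
      (curvature_tensorialOn_left h hx hX hZ).add hY hY', curvature_swap hX hY hZ h.isOpen hx,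
      curvature_swap hX hY' hZ h.isOpen hx, neg_add]

/-- First derivatives of `f` cancel by symmetry in `X` and `Y`; what remains is `(X Y f - Y X f -
[X, Y] f) Z`, which vanishes by `mvfderiv_commutator_smul`. -/
theorem curvature_tensorialOn_right (h : IsOrthonormalFrameOn e U) (hx : x ∈ U)
    (hX : SmoothFieldOn U X) (hY : SmoothFieldOn U Y) :
    TensorialOn U x fun Z ↦ curvature X Y Z x where
  smul {f Z} hf hZ := by
    have hU := h.isOpen
    have m {X : (x : M) → TangentSpace I x} (hX : SmoothFieldOn U X) {y : M} (hy : y ∈ U) :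
      MDiffAt (T% X) y := hX.mdiffAt hU hy
    have hfx {y : M} (hy : y ∈ U) := mdiffAt_of_contMDiffOn hf hU hy
    have key (X Y : (x : M) → TangentSpace I x) (hX : SmoothFieldOn U X) (hY : SmoothFieldOn U Y) :
        nabla X (nabla Y (f • Z)) x = f x • nabla X (nabla Y Z) x
          + mvfderiv I f x (X x) • nabla Y Z x + mvfderiv I f x (Y x) • nabla X Z x
          + mvfderiv I (fun y ↦ mvfderiv I f y (Y y)) x (X x) • Z x := by
      have e1 : nabla Y (f • Z) =ᶠ[𝓝 x] f • nabla Y Z + (fun y ↦ mvfderiv I f y (Y y)) • Z := by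
        filter_upwards [hU.mem_nhds hx] with y hy
        exact nabla_smul_right (m hY hy) (m hZ hy) (hfx hy)
      have hYf := hY.mvfderiv_apply hf hU
      have hYZ := h.smooth_nabla hY hZ
      rw [nabla_congr_right e1, nabla_add_right (m hX hx) (m (SmoothFieldOn.smul hf hYZ) hx)
        (m (SmoothFieldOn.smul hYf hZ) hx), nabla_smul_right (m hX hx) (m hYZ hx) (hfx hx),
        nabla_smul_right (m hX hx) (m hZ hx) (mdiffAt_of_contMDiffOn hYf hU hx)]
      abel
    have hc := mvfderiv_commutator_smul hX hY hZ hf hU hx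
    rw [curvature, key X Y hX hY, key Y X hY hX,
      nabla_smul_right (m (hX.mlieBracket hY hU) hx) (m hZ hx) (hfx hx), curvature]
    simp only [sub_smul, smul_sub] at hc ⊢
    rw [sub_eq_zero] at hc
    rw [← hc]
    abel
  add {Z Z'} hZ hZ' := by
    have hU := h.isOpen
    have m {X : (x : M) → TangentSpace I x} (hX : SmoothFieldOn U X) {y : M} (hy : y ∈ U) :
      MDiffAt (T% X) y := hX.mdiffAt hU hy
    have key (X Y : (x : M) → TangentSpace I x) (hX : SmoothFieldOn U X) (hY : SmoothFieldOn U Y) :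
        nabla X (nabla Y (Z + Z')) x = nabla X (nabla Y Z) x + nabla X (nabla Y Z') x := by
      have e1 : nabla Y (Z + Z') =ᶠ[𝓝 x] nabla Y Z + nabla Y Z' := by
        filter_upwards [hU.mem_nhds hx] with y hy
        exact nabla_add_right (m hY hy) (m hZ hy) (m hZ' hy)
      rw [nabla_congr_right e1, nabla_add_right (m hX hx) (m (h.smooth_nabla hY hZ) hx)
        (m (h.smooth_nabla hY hZ') hx)]
    rw [curvature, key X Y hX hY, key Y X hY hX,
      nabla_add_right (m (hX.mlieBracket hY hU) hx) (m hZ hx) (m hZ' hx), curvature, curvature]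
    abel

/-- The curvature tensor at a point in terms of the curvature of an orthonormal frame. -/
noncomputable def frameCurvature (e : ι → (x : M) → TangentSpace I x) (x : M)
    (u v w : TangentSpace I x) : TangentSpace I x :=
  ∑ p, ⟪e p x, u⟫_ℝ • ∑ q, ⟪e q x, v⟫_ℝ • ∑ r, ⟪e r x, w⟫_ℝ • curvature (e p) (e q) (e r) x

theorem curvature_eq_frameCurvature (h : IsOrthonormalFrameOn e U) (hx : x ∈ U)
    (hX : SmoothFieldOn U X) (hY : SmoothFieldOn U Y) (hZ : SmoothFieldOn U Z) :
    curvature X Y Z x = frameCurvature e x (X x) (Y x) (Z x) := by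
  rw [(curvature_tensorialOn_left h hx hY hZ).eq_sum_frame h hx hX, frameCurvature]
  refine Finset.sum_congr rfl fun p _ ↦ ?_
  rw [(curvature_tensorialOn_mid h hx (h.smooth p) hZ).eq_sum_frame h hx hY]
  congr 1
  refine Finset.sum_congr rfl fun q _ ↦ ?_
  rw [(curvature_tensorialOn_right h hx (h.smooth p) (h.smooth q)).eq_sum_frame h hx hZ]

/-- The extensions of `u` and `v` are smooth only near `x`, so the frame is first restricted to a
common neighbourhood. The right-hand side is multilinear in the vectors, as the trace arguments
require. -/
theorem sectional_eq_frameCurvature (h : IsOrthonormalFrameOn e U) (hx : x ∈ U)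
    (u v : TangentSpace I x) : sectional u v = ⟪frameCurvature e x u v v, u⟫_ℝ := by
  obtain ⟨V, hV, hxV, hu⟩ := exists_smoothFieldOn_vecExt u
  obtain ⟨W, hW, hxW, hv⟩ := exists_smoothFieldOn_vecExt v
  have hs : IsOpen (U ∩ (V ∩ W)) := h.isOpen.inter (hV.inter hW)
  have h' := h.mono hs Set.inter_subset_left
  rw [sectional, curvature_eq_frameCurvature h' ⟨hx, hxV, hxW⟩
    (hu.mono fun y hy ↦ hy.2.1) (hv.mono fun y hy ↦ hy.2.2) (hv.mono fun y hy ↦ hy.2.2)]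
  simp only [vecExt_self]

theorem frameCurvature_frame (h : IsOrthonormalFrameOn e U) (hx : x ∈ U) (p q r : ι) :
    frameCurvature e x (e p x) (e q x) (e r x) = curvature (e p) (e q) (e r) x :=
  (curvature_eq_frameCurvature h hx (h.smooth p) (h.smooth q) (h.smooth r)).symm

end Curvature
-- Traces, projections and complements in an orthonormal family
section LinearAlgebra

variable {V : Type*} [NormedAddCommGroup V] [InnerProductSpace ℝ V] {F : Type*} [AddCommGroup F]
  [Module ℝ F] {ι κ : Type*} [Fintype κ] {e : ι → V} {A : Finset ι}

theorem sum_inner_smul_of_mem_span (he : Orthonormal ℝ e) {v : V}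
    (hv : v ∈ Submodule.span ℝ (e '' A)) : ∑ p ∈ A, ⟪e p, v⟫_ℝ • e p = v := by
  classical
  induction hv using Submodule.span_induction with
  | mem v hv =>
    obtain ⟨q, hq, rfl⟩ := hv
    simp only [orthonormal_iff_ite.1 he]
    have hq' : q ∈ A := hq
    simp [hq']
  | zero => simp
  | add v w _ _ hv hw =>
    simp only [inner_add_right, add_smul, Finset.sum_add_distrib, hv, hw]
  | smul c v _ hv =>
    simp only [inner_smul_right, mul_smul, ← Finset.smul_sum, hv]

/-- The trace of a bilinear map over a subspace does not depend on the orthonormal basis. -/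
theorem sum_orthonormalBasis_eq {K : Submodule ℝ V} (he : Orthonormal ℝ e)
    (hK : K = Submodule.span ℝ (e '' A)) (s : OrthonormalBasis κ ℝ K) (β : V →ₗ[ℝ] V →ₗ[ℝ] F) :
    ∑ a, β (s a) (s a) = ∑ p ∈ A, β (e p) (e p) := by
  classical
  have hs (a) : (s a : V) = ∑ p ∈ A, ⟪e p, (s a : V)⟫_ℝ • e p :=
    (sum_inner_smul_of_mem_span he (hK ▸ (s a).2)).symm
  have hm : ∀ p ∈ A, e p ∈ K := fun p hp ↦ hK ▸ Submodule.subset_span ⟨p, hp, rfl⟩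
  -- Summing these coefficients over `a` is Parseval's identity in `K`: it gives `⟪e p, e q⟫`, so
  -- only the diagonal terms survive.
  have expand (a) : β (s a) (s a) =
      ∑ p ∈ A, ∑ q ∈ A, (⟪e p, (s a : V)⟫_ℝ * ⟪(s a : V), e q⟫_ℝ) • β (e p) (e q) := by
    conv_lhs => rw [hs a]
    simp only [map_sum, map_smul, LinearMap.sum_apply, LinearMap.smul_apply, Finset.smul_sum,
      smul_smul]
    rw [Finset.sum_comm]
    refine Finset.sum_congr rfl fun p _ ↦ Finset.sum_congr rfl fun q _ ↦ ?_
    rw [real_inner_comm (e q), mul_comm]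
  simp only [expand]
  rw [Finset.sum_comm]
  refine Finset.sum_congr rfl fun p hp ↦ ?_
  rw [Finset.sum_comm, Finset.sum_eq_single_of_mem p hp]
  · rw [← Finset.sum_smul]
    have := s.sum_inner_mul_inner ⟨e p, hm p hp⟩ ⟨e p, hm p hp⟩
    simp only [Submodule.coe_inner] at this
    rw [this, real_inner_self_eq_norm_sq, he.1 p]
    simp
  · intro q hq hqp
    rw [← Finset.sum_smul]
    have := s.sum_inner_mul_inner ⟨e p, hm p hp⟩ ⟨e q, hm q hq⟩
    simp only [Submodule.coe_inner] at this
    rw [this, he.2 hqp.symm, zero_smul]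

theorem starProjection_span_orthonormal {K : Submodule ℝ V} [K.HasOrthogonalProjection]
    (he : Orthonormal ℝ e) (hK : K = Submodule.span ℝ (e '' A)) (v : V) :
    K.starProjection v = ∑ p ∈ A, ⟪e p, v⟫_ℝ • e p := by
  have hm : ∀ p ∈ A, e p ∈ K := fun p hp ↦ hK ▸ Submodule.subset_span ⟨p, hp, rfl⟩
  refine Submodule.eq_starProjection_of_mem_of_inner_eq_zero
    (K.sum_mem fun p hp ↦ K.smul_mem _ (hm p hp)) fun w hw ↦ ?_
  have hw' := sum_inner_smul_of_mem_span he (hK ▸ hw)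
  rw [← hw', inner_sum]
  refine Finset.sum_eq_zero fun q hq ↦ ?_
  rw [inner_smul_right, inner_sub_left, sum_inner, Finset.sum_eq_single_of_mem q hq]
  · rw [inner_smul_left, real_inner_self_eq_norm_sq, he.1 q, real_inner_comm (e q) v]
    simp
  · intro p _ hp
    rw [inner_smul_left, he.2 hp, mul_zero]

theorem orthogonal_span_orthonormal [Fintype ι] [DecidableEq ι] (he : Orthonormal ℝ e)
    (hs : ⊤ ≤ Submodule.span ℝ (Set.range e)) {K : Submodule ℝ V}
    (hK : K = Submodule.span ℝ (e '' A)) : Kᗮ = Submodule.span ℝ (e '' (Aᶜ : Finset ι)) := by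
  have hm : ∀ p ∈ A, e p ∈ K := fun p hp ↦ hK ▸ Submodule.subset_span ⟨p, hp, rfl⟩
  apply le_antisymm
  · intro v hv
    have hv' := sum_inner_smul_of_mem_span (A := Finset.univ) he (v := v)
      (by simpa using hs (Submodule.mem_top : v ∈ ⊤))
    rw [← Finset.sum_compl_add_sum A, Finset.sum_eq_zero (s := A), add_zero] at hv'
    · rw [← hv']
      exact Submodule.sum_mem _ fun p hp ↦ Submodule.smul_mem _ _ (Submodule.subset_span ⟨p, hp, rfl⟩)
    · intro p hp
      rw [(Submodule.mem_orthogonal K v).1 hv _ (hm p hp), zero_smul]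
  · rw [Submodule.span_le]
    rintro _ ⟨q, hq, rfl⟩
    rw [SetLike.mem_coe, hK, Submodule.mem_orthogonal]
    intro u hu
    rw [← sum_inner_smul_of_mem_span he hu, sum_inner]
    refine Finset.sum_eq_zero fun p hp ↦ ?_
    have : p ≠ q := by
      rintro rfl
      simp at hq
      exact hq hp
    rw [inner_smul_left, he.2 this, mul_zero]

end LinearAlgebra

/-! ### Existence of smooth adapted orthonormal frames -/

section AdaptedFrames

variable {E : Type*} [NormedAddCommGroup E] [NormedSpace ℝ E] [FiniteDimensional ℝ E]
  {H : Type*} [TopologicalSpace H] {I : ModelWithCorners ℝ E H}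
  {M : Type*} [TopologicalSpace M] [ChartedSpace H M] [IsManifold I ∞ M]
  [RiemannianBundle (fun x : M ↦ TangentSpace I x)]
  [IsContMDiffRiemannianBundle I ∞ E (fun x : M ↦ TangentSpace I x)]
  {x : M} {U : Set M}

open InnerProductSpace in
-- Strong induction along the Gram-Schmidt recursion; linear independence keeps the denominators
-- nonzero on `U`.
theorem smoothFieldOn_gramSchmidt {d : ℕ} {X : Fin d → (y : M) → TangentSpace I y}
    (hX : ∀ j, SmoothFieldOn U (X j)) (hli : ∀ y ∈ U, LinearIndependent ℝ fun j ↦ X j y)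
    (j : Fin d) : SmoothFieldOn U fun y ↦ gramSchmidt ℝ (fun j ↦ X j y) j := by
  induction j using WellFoundedLT.induction with
  | ind j ih =>
    have hc : ∀ i ∈ Finset.Iio j, ContMDiffOn I 𝓘(ℝ, ℝ) ∞ (fun y ↦
        ⟪gramSchmidt ℝ (fun j ↦ X j y) i, X j y⟫_ℝ *
        (⟪gramSchmidt ℝ (fun j ↦ X j y) i, gramSchmidt ℝ (fun j ↦ X j y) i⟫_ℝ)⁻¹) U := by
      intro i hi
      have hi' := ih i (Finset.mem_Iio.1 hi)
      refine (hi'.inner (hX j)).mul ((hi'.inner hi').inv₀ fun y hy ↦ ?_)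
      exact inner_self_ne_zero.2 (gramSchmidt_ne_zero i (hli y hy))
    refine ((hX j).sub (SmoothFieldOn.sum (s := Finset.Iio j) fun i hi ↦
      SmoothFieldOn.smul (hc i hi) (ih i (Finset.mem_Iio.1 hi)))).congr fun y hy ↦ ?_
    refine eq_sub_of_add_eq ?_
    conv_rhs => rw [gramSchmidt_def'' ℝ (fun j ↦ X j y) j]
    congr 1
    refine Finset.sum_congr rfl fun i _ ↦ ?_
    simp [div_eq_mul_inv]

open InnerProductSpace in
/-- A smooth distribution has local orthonormal frames. -/
theorem IsSmoothDistribution.exists_orthonormal {D : (x : M) → Submodule ℝ (TangentSpace I x)}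
    {d : ℕ} (hD : IsSmoothDistribution D d) (x : M) :
    ∃ U : Set M, IsOpen U ∧ x ∈ U ∧ ∃ e : Fin d → (y : M) → TangentSpace I y,
      (∀ j, SmoothFieldOn U (e j)) ∧ ∀ y ∈ U, Orthonormal ℝ (fun j ↦ e j y) ∧
        Submodule.span ℝ (Set.range fun j ↦ e j y) = D y := by
  obtain ⟨U, hU, hx, X, hX, h⟩ := hD x
  have hX' (j) : SmoothFieldOn U (X j) := hX j
  refine ⟨U, hU, hx, fun j y ↦ gramSchmidtNormed ℝ (fun j ↦ X j y) j, fun j ↦ ?_, fun y hy ↦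
    ⟨gramSchmidtNormed_orthonormal (h y hy).1, ?_⟩⟩
  · have hg := smoothFieldOn_gramSchmidt hX' (fun y hy ↦ (h y hy).1) j
    have hn : ContMDiffOn I 𝓘(ℝ, ℝ) ∞ (fun y ↦ (√⟪gramSchmidt ℝ (fun j ↦ X j y) j,
        gramSchmidt ℝ (fun j ↦ X j y) j⟫_ℝ)⁻¹) U := by
      have hne : ∀ y ∈ U, ⟪gramSchmidt ℝ (fun j ↦ X j y) j,
          gramSchmidt ℝ (fun j ↦ X j y) j⟫_ℝ ≠ 0 := fun y hy ↦
        inner_self_ne_zero.2 (gramSchmidt_ne_zero j (h y hy).1)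
      intro y hy
      have hs : ContMDiffAt 𝓘(ℝ, ℝ) 𝓘(ℝ, ℝ) ∞ (fun t : ℝ ↦ (√t)⁻¹)
          ⟪gramSchmidt ℝ (fun j ↦ X j y) j, gramSchmidt ℝ (fun j ↦ X j y) j⟫_ℝ :=
        ((Real.contDiffAt_sqrt (hne y hy)).inv
          ((Real.sqrt_ne_zero real_inner_self_nonneg).2 (hne y hy))).contMDiffAt
      exact ContMDiffAt.comp_contMDiffWithinAt (g := fun t : ℝ ↦ (√t)⁻¹) y hs (hg.inner hg y hy)
    refine (SmoothFieldOn.smul hn hg).congr fun y hy ↦ ?_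
    simp [gramSchmidtNormed]
  · rw [span_gramSchmidtNormed_range, span_gramSchmidt, (h y hy).2]

/-- On `U`, the distribution `D` is spanned by the members of the frame `e` with index in `A`. -/
def IsAdaptedOn {ι : Type*} (e : ι → (x : M) → TangentSpace I x) (U : Set M)
    (D : (x : M) → Submodule ℝ (TangentSpace I x)) (A : Finset ι) : Prop :=
  ∀ y ∈ U, D y = Submodule.span ℝ ((fun p ↦ e p y) '' A)

/-- Each distribution is orthonormalized separately and the frames are joined over a sigma type, so
the first component of an index records its distribution. Pairwise orthogonality makes the union
orthonormal, and the spanning condition makes it a basis. -/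
theorem IsAlmostThreeProduct.exists_adapted_frame
    {D : Fin 3 → (x : M) → Submodule ℝ (TangentSpace I x)} {n : Fin 3 → ℕ}
    (hD : IsAlmostThreeProduct D n) (x : M) :
    ∃ U : Set M, x ∈ U ∧ ∃ e : (Σ i, Fin (n i)) → (y : M) → TangentSpace I y,
      IsOrthonormalFrameOn e U ∧ ∀ i, IsAdaptedOn e U (D i) {p | p.1 = i} := by
  choose V hV hxV f hf h using fun i ↦ (hD.smooth i).exists_orthonormal x
  have hsub (i) : (⋂ i, V i) ⊆ V i := Set.iInter_subset V i
  have hadapt : ∀ i, IsAdaptedOn (fun p : Σ i, Fin (n i) ↦ f p.1 p.2) (⋂ i, V i) (D i)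
      {p | p.1 = i} := by
    intro i y hy
    rw [← (h i y (hsub i hy)).2]
    congr 1
    ext v
    constructor
    · rintro ⟨j, rfl⟩
      exact ⟨⟨i, j⟩, by simp, rfl⟩
    · rintro ⟨⟨k, j⟩, hk, rfl⟩
      obtain rfl : k = i := by simpa using hk
      exact ⟨j, rfl⟩
  refine ⟨⋂ i, V i, Set.mem_iInter.2 hxV, fun p ↦ f p.1 p.2,
    ⟨isOpen_iInter_of_finite hV, fun p ↦ (hf p.1 p.2).mono (hsub _), fun y hy ↦ ⟨fun p ↦
      (h p.1 y (hsub _ hy)).1.1 p.2, ?_⟩, fun y hy ↦ ?_⟩, hadapt⟩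
  · rintro ⟨i, j⟩ ⟨k, l⟩ hne
    have hm (i) (j) : f i j y ∈ D i y := by
      rw [← (h i y (hsub i hy)).2]
      exact Submodule.subset_span ⟨j, rfl⟩
    by_cases hik : i = k
    · subst hik
      exact (h i y (hsub _ hy)).1.2 fun hjl ↦ hne (by congr)
    · exact (hD.orthogonal i k hik y).inner_eq (hm i j) (hm k l)
  · rw [← hD.spans y]
    refine iSup_le fun i ↦ ?_
    rw [hadapt i y hy]
    exact Submodule.span_mono (Set.image_subset_range _ _)

end AdaptedFrames
-- Extrinsic quantities and divergences in connection coefficients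
section Extrinsic

variable {E : Type*} [NormedAddCommGroup E] [NormedSpace ℝ E] [FiniteDimensional ℝ E]
  {H : Type*} [TopologicalSpace H] {I : ModelWithCorners ℝ E H}
  {M : Type*} [TopologicalSpace M] [ChartedSpace H M] [IsManifold I ∞ M]
  [RiemannianBundle (fun x : M ↦ TangentSpace I x)]
  [IsContMDiffRiemannianBundle I ∞ E (fun x : M ↦ TangentSpace I x)]
  {X X' Y Y' Z Z' : (x : M) → TangentSpace I x} {f g : M → ℝ} {x : M} {U : Set M}
  {ι : Type*} [Fintype ι] [DecidableEq ι] {e : ι → (x : M) → TangentSpace I x}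
  {D D' : (x : M) → Submodule ℝ (TangentSpace I x)} {A A' : Finset ι}

theorem IsAdaptedOn.orthogonal (hA : IsAdaptedOn e U D A) (h : IsOrthonormalFrameOn e U) :
    IsAdaptedOn e U (perp D) Aᶜ := fun y hy ↦
  orthogonal_span_orthonormal (h.orthonormal y hy) (h.span y hy) (hA y hy)

theorem IsAdaptedOn.starProjection (hA : IsAdaptedOn e U D A) (h : IsOrthonormalFrameOn e U)
    (hx : x ∈ U) (v : TangentSpace I x) :
    (D x).starProjection v = ∑ p ∈ A, ⟪e p x, v⟫_ℝ • e p x :=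
  starProjection_span_orthonormal (h.orthonormal x hx) (hA x hx) v

theorem IsAdaptedOn.mem (hA : IsAdaptedOn e U D A) (hx : x ∈ U) {p : ι} (hp : p ∈ A) :
    e p x ∈ D x := by
  rw [hA x hx]
  exact Submodule.subset_span ⟨p, hp, rfl⟩

theorem extIn_self {u : TangentSpace I x} (hu : u ∈ D x) : extIn D u x = u := by
  rw [extIn, vecExt_self, Submodule.starProjection_eq_self_iff.2 hu]

theorem IsAdaptedOn.exists_smoothFieldOn_extIn (hA : IsAdaptedOn e U D A)
    (h : IsOrthonormalFrameOn e U) (hx : x ∈ U) (u : TangentSpace I x) :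
    ∃ V ⊆ U, IsOpen V ∧ x ∈ V ∧ SmoothFieldOn V (extIn D u) := by
  obtain ⟨W, hW, hxW, hu⟩ := exists_smoothFieldOn_vecExt u
  refine ⟨U ∩ W, Set.inter_subset_left, h.isOpen.inter hW, ⟨hx, hxW⟩, ?_⟩
  have he (p) : SmoothFieldOn (U ∩ W) (e p) := (h.smooth p).mono Set.inter_subset_left
  refine (SmoothFieldOn.sum (s := A) fun p _ ↦ SmoothFieldOn.smul
    ((he p).inner (hu.mono Set.inter_subset_right)) (he p)).congr fun y hy ↦ ?_
  exact hA.starProjection h hy.1 _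

theorem IsOrthonormalFrameOn.mdiffAt (h : IsOrthonormalFrameOn e U) (hx : x ∈ U) (p : ι) :
    MDiffAt (T% (e p)) x := (h.smooth p).mdiffAt h.isOpen hx

/-- The bilinear form `(u, v) ↦ -⟪∇_u e_i, v⟫` at `x`. -/
noncomputable def weingarten (h : IsOrthonormalFrameOn e U) (hx : x ∈ U) (i : ι) :
    TangentSpace I x →ₗ[ℝ] TangentSpace I x →ₗ[ℝ] ℝ :=
  -(innerₗ (TangentSpace I x) ∘ₗ (covDeriv (e i) x (h.mdiffAt hx i)).toLinearMap)

/-- Differentiating `⟪V, e_i⟫ = 0` for a section `V` of `D` moves the derivative onto `e_i`. The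
normal part of the connection therefore depends only on the values `u`, `v` and is the restriction
of a bilinear form on the whole tangent space. -/
theorem IsAdaptedOn.inner_nabla_extIn (hA : IsAdaptedOn e U D A) (h : IsOrthonormalFrameOn e U)
    (hx : x ∈ U) {u v : TangentSpace I x} (hu : u ∈ D x) (hv : v ∈ D x) {i : ι} (hi : i ∈ Aᶜ) :
    ⟪e i x, nabla (extIn D u) (extIn D v) x⟫_ℝ = weingarten h hx i u v := by
  obtain ⟨V, hVU, hV, hxV, hus⟩ := hA.exists_smoothFieldOn_extIn h hx u
  obtain ⟨W, hWU, hW, hxW, hvs⟩ := hA.exists_smoothFieldOn_extIn h hx v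
  have hud := hus.mdiffAt hV hxV
  have hvd := hvs.mdiffAt hW hxW
  have hz : (fun y ↦ ⟪extIn D v y, e i y⟫_ℝ) =ᶠ[𝓝 x] fun _ ↦ (0 : ℝ) := by
    filter_upwards [h.isOpen.mem_nhds hx] with y hy
    have h1 : extIn D v y ∈ D y := Submodule.starProjection_apply_mem _ _
    have h2 : e i y ∈ (D y)ᗮ := (hA.orthogonal h).mem hy hi
    exact h2 _ h1
  have := mvfderiv_inner hud hvd (h.mdiffAt hx i)
  rw [mvfderiv_congr_of_eventuallyEq hz, mvfderiv_const, extIn_self hv, extIn_self hu] at this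
  simp only [weingarten, LinearMap.neg_apply, LinearMap.comp_apply, innerₗ_apply_apply]
  rw [real_inner_comm]
  have e1 : nabla (extIn D u) (e i) x = covDeriv (e i) x (h.mdiffAt hx i) u := by
    rw [← covDeriv_apply hud (h.mdiffAt hx i), extIn_self hu]
  rw [e1, real_inner_comm _ v, zero_apply] at this
  exact eq_neg_of_add_eq_zero_left this.symm

/-- The `ε`-symmetrized normal part of the connection on `D`, as a bilinear map: the second
fundamental form for `ε = 1` and the integrability tensor for `ε = -1`. -/
noncomputable def normalForm (h : IsOrthonormalFrameOn e U) (hx : x ∈ U) (A : Finset ι) (ε : ℝ) :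
    TangentSpace I x →ₗ[ℝ] TangentSpace I x →ₗ[ℝ] TangentSpace I x :=
  ∑ i ∈ Aᶜ, ((1 / 2 : ℝ) • (weingarten h hx i + ε • (weingarten h hx i).flip)).compr₂
    (LinearMap.toSpanSingleton ℝ _ (e i x))

theorem normalForm_apply (h : IsOrthonormalFrameOn e U) (hx : x ∈ U) (ε : ℝ)
    (u v : TangentSpace I x) : normalForm h hx A ε u v =
      ∑ i ∈ Aᶜ, (1 / 2 * (weingarten h hx i u v + ε * weingarten h hx i v u)) • e i x := by
  simp [normalForm, LinearMap.sum_apply, mul_add]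

theorem IsAdaptedOn.secondFF_eq (hA : IsAdaptedOn e U D A) (h : IsOrthonormalFrameOn e U)
    (hx : x ∈ U) {u v : TangentSpace I x} (hu : u ∈ D x) (hv : v ∈ D x) :
    secondFF D u v = normalForm h hx A 1 u v := by
  rw [secondFF, (hA.orthogonal h).starProjection h hx, normalForm_apply, Finset.smul_sum]
  refine Finset.sum_congr rfl fun i hi ↦ ?_
  rw [inner_add_right, hA.inner_nabla_extIn h hx hu hv hi, hA.inner_nabla_extIn h hx hv hu hi,
    smul_smul, one_mul]

theorem IsAdaptedOn.integrability_eq (hA : IsAdaptedOn e U D A) (h : IsOrthonormalFrameOn e U)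
    (hx : x ∈ U) {u v : TangentSpace I x} (hu : u ∈ D x) (hv : v ∈ D x) :
    integrability D u v = normalForm h hx A (-1) u v := by
  rw [integrability, (hA.orthogonal h).starProjection h hx, normalForm_apply, Finset.smul_sum]
  refine Finset.sum_congr rfl fun i hi ↦ ?_
  rw [inner_sub_right, hA.inner_nabla_extIn h hx hu hv hi, hA.inner_nabla_extIn h hx hv hu hi,
    smul_smul, neg_one_mul, sub_eq_add_neg]

/-- The connection coefficients of a frame. -/
noncomputable def connCoeff (e : ι → (x : M) → TangentSpace I x) (p q r : ι) (y : M) : ℝ :=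
  ⟪nabla (e p) (e q) y, e r y⟫_ℝ

/-- Metric compatibility applied to the locally constant function `⟪e q, e r⟫`. -/
theorem connCoeff_antisymm (h : IsOrthonormalFrameOn e U) (hx : x ∈ U) (p q r : ι) :
    connCoeff e p q r x = - connCoeff e p r q x := by
  have hz : (fun y ↦ ⟪e q y, e r y⟫_ℝ) =ᶠ[𝓝 x] fun _ ↦ (if q = r then 1 else 0 : ℝ) := by
    filter_upwards [h.isOpen.mem_nhds hx] with y hy
    exact orthonormal_iff_ite.1 (h.orthonormal y hy) q r
  have := mvfderiv_inner (h.mdiffAt hx p) (h.mdiffAt hx q) (h.mdiffAt hx r)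
  rw [mvfderiv_congr_of_eventuallyEq hz, mvfderiv_const, real_inner_comm _ (e q x),
    zero_apply] at this
  exact eq_neg_of_add_eq_zero_left this.symm

theorem connCoeff_smooth (h : IsOrthonormalFrameOn e U) (p q r : ι) :
    ContMDiffOn I 𝓘(ℝ, ℝ) ∞ (connCoeff e p q r) U :=
  (h.smooth_nabla (h.smooth p) (h.smooth q)).inner (h.smooth r)

theorem weingarten_frame (h : IsOrthonormalFrameOn e U) (hx : x ∈ U) (p q i : ι) :
    weingarten h hx i (e p x) (e q x) = connCoeff e p q i x := by
  rw [connCoeff_antisymm h hx]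
  simp only [weingarten, LinearMap.neg_apply, LinearMap.comp_apply, innerₗ_apply_apply, connCoeff]
  rw [← covDeriv_apply (h.mdiffAt hx p) (h.mdiffAt hx i)]
  rfl

theorem IsAdaptedOn.meanCurvature_eq (hA : IsAdaptedOn e U D A) (h : IsOrthonormalFrameOn e U)
    (hx : x ∈ U) :
    meanCurvature D x = ∑ i ∈ Aᶜ, (∑ a ∈ A, connCoeff e a a i x) • e i x := by
  have h1 : meanCurvature D x = ∑ a, normalForm h hx A 1 (stdOrthonormalBasis ℝ (D x) a)
      (stdOrthonormalBasis ℝ (D x) a) :=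
    Finset.sum_congr rfl fun a _ ↦ hA.secondFF_eq h hx (Subtype.mem _) (Subtype.mem _)
  rw [h1, sum_orthonormalBasis_eq (h.orthonormal x hx) (hA x hx)]
  simp only [normalForm_apply, weingarten_frame]
  rw [Finset.sum_comm]
  refine Finset.sum_congr rfl fun i _ ↦ ?_
  rw [Finset.sum_smul]
  refine Finset.sum_congr rfl fun a _ ↦ ?_
  congr 1
  ring

theorem IsAdaptedOn.smoothFieldOn_meanCurvature (hA : IsAdaptedOn e U D A)
    (h : IsOrthonormalFrameOn e U) : SmoothFieldOn U (meanCurvature D) :=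
  (SmoothFieldOn.sum (s := Aᶜ) fun i _ ↦ SmoothFieldOn.smul
    (f := fun y ↦ ∑ a ∈ A, connCoeff e a a i y)
    (contMDiffOn_finsetSum fun a _ ↦ connCoeff_smooth h a a i) (h.smooth i)).congr
    fun _ hy ↦ hA.meanCurvature_eq h hy

theorem IsOrthonormalFrameOn.norm_sq_sum (h : IsOrthonormalFrameOn e U) (hx : x ∈ U)
    (B : Finset ι) (c : ι → ℝ) : ‖∑ i ∈ B, c i • e i x‖ ^ 2 = ∑ i ∈ B, c i ^ 2 := by
  rw [← real_inner_self_eq_norm_sq, (h.orthonormal x hx).inner_sum]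
  simp [sq]

/-- A squared norm is the diagonal of a bilinear form in each argument of the normal form, so basis
independence of the trace is applied to one slot at a time. -/
theorem IsAdaptedOn.sum_norm_sq_normalForm (hA : IsAdaptedOn e U D A)
    (h : IsOrthonormalFrameOn e U) (hx : x ∈ U) (ε : ℝ) :
    ∑ a, ∑ b, ‖normalForm h hx A ε (stdOrthonormalBasis ℝ (D x) a : TangentSpace I x)
      (stdOrthonormalBasis ℝ (D x) b : TangentSpace I x)‖ ^ 2 =
    ∑ a ∈ A, ∑ b ∈ A, ∑ i ∈ Aᶜ,
      (1 / 2 * (connCoeff e a b i x + ε * connCoeff e b a i x)) ^ 2 := by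
  set B := normalForm h hx A ε
  have ho := h.orthonormal x hx
  have h1 (u : TangentSpace I x) : ∑ b, ‖B u (stdOrthonormalBasis ℝ (D x) b)‖ ^ 2 =
      ∑ b ∈ A, ‖B u (e b x)‖ ^ 2 := by
    simpa using sum_orthonormalBasis_eq ho (hA x hx) (stdOrthonormalBasis ℝ (D x))
      ((innerₗ (TangentSpace I x)).compl₁₂ (B u) (B u))
  have h2 (v : TangentSpace I x) : ∑ a, ‖B (stdOrthonormalBasis ℝ (D x) a) v‖ ^ 2 =
      ∑ a ∈ A, ‖B (e a x) v‖ ^ 2 := by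
    simpa using sum_orthonormalBasis_eq ho (hA x hx) (stdOrthonormalBasis ℝ (D x))
      ((innerₗ (TangentSpace I x)).compl₁₂ (B.flip v) (B.flip v))
  simp only [h1]
  rw [Finset.sum_comm]
  simp only [h2]
  rw [Finset.sum_comm]
  refine Finset.sum_congr rfl fun a _ ↦ Finset.sum_congr rfl fun b _ ↦ ?_
  simp only [B, normalForm_apply, weingarten_frame]
  exact h.norm_sq_sum hx _ _

/-- Polarization: `((s + t) / 2)² - ((s - t) / 2)² = s t`. Only this difference of the two norms
enters `Q`. -/
theorem IsAdaptedOn.normSq_sub_normSq (hA : IsAdaptedOn e U D A) (h : IsOrthonormalFrameOn e U)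
    (hx : x ∈ U) : normSqSecondFF D x - normSqIntegrability D x =
      ∑ a ∈ A, ∑ b ∈ A, ∑ i ∈ Aᶜ, connCoeff e a b i x * connCoeff e b a i x := by
  have h1 : normSqSecondFF D x = _ := (Finset.sum_congr rfl fun a _ ↦ Finset.sum_congr rfl
    fun b _ ↦ by rw [hA.secondFF_eq h hx (Subtype.mem _) (Subtype.mem _)]).trans
      (hA.sum_norm_sq_normalForm h hx 1)
  have h2 : normSqIntegrability D x = _ := (Finset.sum_congr rfl fun a _ ↦ Finset.sum_congr rfl
    fun b _ ↦ by rw [hA.integrability_eq h hx (Subtype.mem _) (Subtype.mem _)]).trans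
      (hA.sum_norm_sq_normalForm h hx (-1))
  rw [h1, h2]
  simp only [← Finset.sum_sub_distrib]
  refine Finset.sum_congr rfl fun a _ ↦ Finset.sum_congr rfl fun b _ ↦
    Finset.sum_congr rfl fun i _ ↦ ?_
  ring

theorem IsAdaptedOn.norm_sq_meanCurvature (hA : IsAdaptedOn e U D A)
    (h : IsOrthonormalFrameOn e U) (hx : x ∈ U) :
    ‖meanCurvature D x‖ ^ 2 = ∑ i ∈ Aᶜ, (∑ a ∈ A, connCoeff e a a i x) ^ 2 := by
  rw [hA.meanCurvature_eq h hx, h.norm_sq_sum hx]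

/-- The divergence is the trace of `covDeriv`, computable in any orthonormal basis. -/
theorem divergence_eq_sum_frame (h : IsOrthonormalFrameOn e U) (hx : x ∈ U)
    (hX : MDiffAt (T% X) x) : divergence X x = ∑ p, ⟪nabla (e p) X x, e p x⟫_ℝ := by
  have h1 := LinearMap.trace_eq_sum_inner (covDeriv X x hX).toLinearMap
    (stdOrthonormalBasis ℝ (TangentSpace I x))
  have h2 := LinearMap.trace_eq_sum_inner (covDeriv X x hX).toLinearMap (h.basis hx)
  calc divergence X x = _ := Finset.sum_congr rfl fun i _ ↦ real_inner_comm _ _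
    _ = _ := h1.symm
    _ = _ := h2
    _ = _ := Finset.sum_congr rfl fun p _ ↦ by
      rw [h.basis_apply, real_inner_comm, ← covDeriv_apply (h.mdiffAt hx p) hX]
      rfl

theorem divergence_congr (h : X =ᶠ[𝓝 x] Y) : divergence X x = divergence Y x := by
  simp only [divergence, nabla_congr_right h]

theorem divergence_add (hX : MDiffAt (T% X) x) (hY : MDiffAt (T% Y) x) :
    divergence (X + Y) x = divergence X x + divergence Y x := by
  simp only [divergence, nabla_add_right (mdifferentiableAt_vecExt _) hX hY, inner_add_left,
    Finset.sum_add_distrib]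

theorem divergence_sub (hX : MDiffAt (T% X) x) (hY : MDiffAt (T% Y) x) :
    divergence (X - Y) x = divergence X x - divergence Y x := by
  have := divergence_add (mdifferentiableAt_sub_section hX hY) hY
  rw [sub_add_cancel] at this
  rw [this, add_sub_cancel_right]

theorem divergence_smul_frame (h : IsOrthonormalFrameOn e U) (hx : x ∈ U) (hf : MDiffAt f x)
    (i : ι) : divergence (f • e i) x =
      mvfderiv I f x (e i x) + f x * ∑ p, connCoeff e p i p x := by
  rw [divergence_eq_sum_frame h hx (hf.smul_section (h.mdiffAt hx i))]
  simp only [nabla_smul_right (h.mdiffAt hx _) (h.mdiffAt hx i) hf, inner_add_left,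
    inner_smul_left, conj_trivial, Finset.sum_add_distrib, Finset.mul_sum,
    orthonormal_iff_ite.1 (h.orthonormal x hx)]
  simp [connCoeff, add_comm]

theorem divergence_sum_smul_frame (h : IsOrthonormalFrameOn e U) (hx : x ∈ U) {c : ι → M → ℝ}
    (hc : ∀ i, ContMDiffOn I 𝓘(ℝ, ℝ) ∞ (c i) U) (B : Finset ι) :
    divergence (fun y ↦ ∑ i ∈ B, c i y • e i y) x =
      ∑ i ∈ B, (mvfderiv I (c i) x (e i x) + c i x * ∑ p, connCoeff e p i p x) := by
  induction B using Finset.induction_on with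
  | empty =>
    simp only [Finset.sum_empty]
    have hz : MDiffAt (T% (0 : (x : M) → TangentSpace I x)) x := by
      have := (mdifferentiableAt_vecExt (0 : TangentSpace I x))
      have h0 := mdifferentiableAt_sub_section this this
      rwa [sub_self] at h0
    have := divergence_add hz hz
    rw [add_zero] at this
    exact left_eq_add.1 this
  | insert i B hi ih =>
    rw [Finset.sum_insert hi, ← ih, ← divergence_smul_frame h hx
      (mdiffAt_of_contMDiffOn (hc i) h.isOpen hx), ← divergence_add]
    · simp only [Finset.sum_insert hi]
      rfl
    · exact (SmoothFieldOn.smul (hc i) (h.smooth i)).mdiffAt h.isOpen hx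
    · exact (SmoothFieldOn.sum fun i _ ↦ SmoothFieldOn.smul (hc i) (h.smooth i)).mdiffAt h.isOpen hx

theorem mvfderiv_sum {κ : Type*} (s : Finset κ) {c : κ → M → ℝ} (hU : IsOpen U) (hx : x ∈ U)
    (hc : ∀ i, ContMDiffOn I 𝓘(ℝ, ℝ) ∞ (c i) U) (v : TangentSpace I x) :
    mvfderiv I (fun y ↦ ∑ i ∈ s, c i y) x v = ∑ i ∈ s, mvfderiv I (c i) x v := by
  classical
  induction s using Finset.induction_on with
  | empty => simp [mvfderiv_const]
  | insert i s hi ih =>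
    simp only [Finset.sum_insert hi, ← ih]
    rw [mvfderiv_fun_add (mdiffAt_of_contMDiffOn (hc i) hU hx)
      (mdiffAt_of_contMDiffOn (contMDiffOn_finsetSum fun i _ ↦ hc i) hU hx)]
    rfl

theorem IsAdaptedOn.divergence_meanCurvature (hA : IsAdaptedOn e U D A)
    (h : IsOrthonormalFrameOn e U) (hx : x ∈ U) :
    divergence (meanCurvature D) x =
      ∑ i ∈ Aᶜ, (∑ a ∈ A, mvfderiv I (connCoeff e a a i) x (e i x)
        + (∑ a ∈ A, connCoeff e a a i x) * ∑ p, connCoeff e p i p x) := by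
  have hc (i) : ContMDiffOn I 𝓘(ℝ, ℝ) ∞ (fun y ↦ ∑ a ∈ A, connCoeff e a a i y) U :=
    contMDiffOn_finsetSum fun a _ ↦ connCoeff_smooth h a a i
  rw [divergence_congr (X := meanCurvature D) (Filter.eventually_of_mem (h.isOpen.mem_nhds hx)
    fun y hy ↦ hA.meanCurvature_eq h hy)]
  refine (divergence_sum_smul_frame h hx hc Aᶜ).trans (Finset.sum_congr rfl fun i _ ↦ ?_)
  rw [mvfderiv_sum A h.isOpen hx fun a ↦ connCoeff_smooth h a a i]

end Extrinsic
-- Quadratic identity for antisymmetric coefficients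
section Algebra

variable {ι : Type*} [Fintype ι] [DecidableEq ι]

/-- The part of the mixed curvature that is quadratic in the connection coefficients. -/
theorem sum_curvature_quadratic_eq {γ : ι → ι → ι → ℝ} (hγ : ∀ p q r, γ p q r = - γ p r q)
    (A : Finset ι) :
    ∑ a ∈ A, ∑ i ∈ Aᶜ, (-∑ r, γ i i r * γ a a r + ∑ r, γ a i r * γ i a r
        - ∑ r, (γ a i r - γ i a r) * γ r i a) =
      ∑ i ∈ Aᶜ, (∑ a ∈ A, γ a a i) * ∑ p, γ p i p + ∑ a ∈ A, (∑ i ∈ Aᶜ, γ i i a) * ∑ p, γ p a p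
        - ∑ a ∈ A, ∑ b ∈ A, ∑ i ∈ Aᶜ, γ a b i * γ b a i
        - ∑ i ∈ Aᶜ, ∑ j ∈ Aᶜ, ∑ a ∈ A, γ i j a * γ j i a
        + ∑ i ∈ Aᶜ, (∑ a ∈ A, γ a a i) ^ 2 + ∑ a ∈ A, (∑ i ∈ Aᶜ, γ i i a) ^ 2 := by
  set B := Aᶜ with hB
  have split (F : ι → ℝ) : ∑ r, F r = ∑ r ∈ A, F r + ∑ r ∈ B, F r :=
    (Finset.sum_add_sum_compl A F).symm
  have traces : ∑ a ∈ A, ∑ i ∈ B, ∑ r, γ i i r * γ a a r =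
      ∑ r ∈ A, (∑ i ∈ B, γ i i r) * (∑ a ∈ A, γ a a r)
        + ∑ r ∈ B, (∑ i ∈ B, γ i i r) * (∑ a ∈ A, γ a a r) := by
    rw [← split]
    simp only [Finset.sum_mul_sum]
    rw [Finset.sum_comm]
    simp only [Finset.sum_comm (s := A) (t := Finset.univ)]
    rw [Finset.sum_comm]
  -- The divergence of a frame field is minus the sum of both traces. In the products on the right
  -- this produces minus the squared traces, cancelling the explicit squares, and leaves the cross
  -- terms matching `traces`.
  have tr (r : ι) : ∑ p, γ p r p = -(∑ a ∈ A, γ a a r + ∑ i ∈ B, γ i i r) := by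
    rw [← split, ← Finset.sum_neg_distrib]
    exact Finset.sum_congr rfl fun p _ ↦ hγ p r p
  -- Of the three products, the first and third cancel after exchanging `a` and `b`, by one sign
  -- change; the second is the required term after two sign changes.
  have mixed₁ : ∑ a ∈ A, ∑ i ∈ B, ∑ b ∈ A, (γ a i b * γ i a b - (γ a i b - γ i a b) * γ b i a) =
      - ∑ a ∈ A, ∑ b ∈ A, ∑ i ∈ B, γ a b i * γ b a i := by
    have e1 : ∑ a ∈ A, ∑ i ∈ B, ∑ b ∈ A, γ a i b * γ i a b =
        - ∑ a ∈ A, ∑ i ∈ B, ∑ b ∈ A, γ i a b * γ b i a := by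
      rw [Finset.sum_comm, Finset.sum_comm (s := A), ← Finset.sum_neg_distrib]
      refine Finset.sum_congr rfl fun i _ ↦ ?_
      rw [Finset.sum_comm, ← Finset.sum_neg_distrib]
      refine Finset.sum_congr rfl fun a _ ↦ ?_
      rw [← Finset.sum_neg_distrib]
      refine Finset.sum_congr rfl fun b _ ↦ ?_
      rw [hγ i a b]
      ring
    have e2 : ∑ a ∈ A, ∑ i ∈ B, ∑ b ∈ A, γ a i b * γ b i a =
        ∑ a ∈ A, ∑ b ∈ A, ∑ i ∈ B, γ a b i * γ b a i := by
      refine Finset.sum_congr rfl fun a _ ↦ ?_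
      rw [Finset.sum_comm]
      refine Finset.sum_congr rfl fun b _ ↦ Finset.sum_congr rfl fun i _ ↦ ?_
      rw [hγ a b i, hγ b a i]
      ring
    simp only [sub_mul, Finset.sum_sub_distrib]
    rw [e1, e2]
    ring
  -- Here the first and second products cancel after exchanging `i` and `j`, and the third is the
  -- required term after one sign change.
  have mixed₂ : ∑ a ∈ A, ∑ i ∈ B, ∑ j ∈ B, (γ a i j * γ i a j - (γ a i j - γ i a j) * γ j i a) =
      - ∑ i ∈ B, ∑ j ∈ B, ∑ a ∈ A, γ i j a * γ j i a := by
    have e1 : ∑ a ∈ A, ∑ i ∈ B, ∑ j ∈ B, γ a i j * γ i a j =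
        ∑ a ∈ A, ∑ i ∈ B, ∑ j ∈ B, γ a i j * γ j i a := by
      refine Finset.sum_congr rfl fun a _ ↦ ?_
      rw [Finset.sum_comm]
      refine Finset.sum_congr rfl fun i _ ↦ Finset.sum_congr rfl fun j _ ↦ ?_
      rw [hγ a j i, hγ j a i]
      ring
    have e2 : ∑ a ∈ A, ∑ i ∈ B, ∑ j ∈ B, γ i a j * γ j i a =
        - ∑ i ∈ B, ∑ j ∈ B, ∑ a ∈ A, γ i j a * γ j i a := by
      rw [Finset.sum_comm, ← Finset.sum_neg_distrib]
      refine Finset.sum_congr rfl fun i _ ↦ ?_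
      rw [Finset.sum_comm, ← Finset.sum_neg_distrib]
      refine Finset.sum_congr rfl fun j _ ↦ ?_
      rw [← Finset.sum_neg_distrib]
      refine Finset.sum_congr rfl fun a _ ↦ ?_
      rw [hγ i a j]
      ring
    simp only [sub_mul, Finset.sum_sub_distrib]
    rw [e1, e2]
    ring
  have lhs : ∑ a ∈ A, ∑ i ∈ B, (-∑ r, γ i i r * γ a a r + ∑ r, γ a i r * γ i a r
        - ∑ r, (γ a i r - γ i a r) * γ r i a) =
      - ∑ a ∈ A, ∑ i ∈ B, ∑ r, γ i i r * γ a a r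
      + ∑ a ∈ A, ∑ i ∈ B, ∑ b ∈ A, (γ a i b * γ i a b - (γ a i b - γ i a b) * γ b i a)
      + ∑ a ∈ A, ∑ i ∈ B, ∑ j ∈ B, (γ a i j * γ i a j - (γ a i j - γ i a j) * γ j i a) := by
    simp only [← Finset.sum_neg_distrib, ← Finset.sum_add_distrib]
    refine Finset.sum_congr rfl fun a _ ↦ Finset.sum_congr rfl fun i _ ↦ ?_
    rw [Finset.sum_add_distrib, Finset.sum_sub_distrib, Finset.sum_sub_distrib,
      split fun r ↦ γ a i r * γ i a r, split fun r ↦ (γ a i r - γ i a r) * γ r i a,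
      Finset.sum_neg_distrib]
    ring
  rw [lhs, mixed₁, mixed₂, traces]
  simp only [tr]
  have r1 : ∑ i ∈ B, (∑ a ∈ A, γ a a i) * -(∑ a ∈ A, γ a a i + ∑ j ∈ B, γ j j i) =
      - ∑ i ∈ B, (∑ a ∈ A, γ a a i) ^ 2
      - ∑ r ∈ B, (∑ i ∈ B, γ i i r) * (∑ a ∈ A, γ a a r) := by
    rw [← Finset.sum_neg_distrib, ← Finset.sum_sub_distrib]
    exact Finset.sum_congr rfl fun i _ ↦ by ring
  have r2 : ∑ a ∈ A, (∑ i ∈ B, γ i i a) * -(∑ b ∈ A, γ b b a + ∑ i ∈ B, γ i i a) =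
      - ∑ a ∈ A, (∑ i ∈ B, γ i i a) ^ 2
      - ∑ r ∈ A, (∑ i ∈ B, γ i i r) * (∑ a ∈ A, γ a a r) := by
    rw [← Finset.sum_neg_distrib, ← Finset.sum_sub_distrib]
    exact Finset.sum_congr rfl fun i _ ↦ by ring
  rw [r1, r2]
  ring

end Algebra

/-! ### Sectional curvature in a frame and Walczak's formula -/

section Walczak

variable {E : Type*} [NormedAddCommGroup E] [NormedSpace ℝ E] [FiniteDimensional ℝ E]
  {H : Type*} [TopologicalSpace H] {I : ModelWithCorners ℝ E H}
  {M : Type*} [TopologicalSpace M] [ChartedSpace H M] [IsManifold I ∞ M]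
  [RiemannianBundle (fun x : M ↦ TangentSpace I x)]
  [IsContMDiffRiemannianBundle I ∞ E (fun x : M ↦ TangentSpace I x)]
  {x : M} {U : Set M}
  {ι : Type*} [Fintype ι] [DecidableEq ι] {e : ι → (x : M) → TangentSpace I x}
  {D D' : (x : M) → Submodule ℝ (TangentSpace I x)} {A A' : Finset ι}

/-- The sectional curvature of the plane spanned by two members of a frame. -/
noncomputable def frameSectional (e : ι → (x : M) → TangentSpace I x) (x : M) (p q : ι) : ℝ :=
  ⟪curvature (e p) (e q) (e q) x, e p x⟫_ℝ

/-- For fixed `v` the form `⟪R(u, v) v, u'⟫` is bilinear in `u, u'`, and for fixed `u` the form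
`⟪R(u, v) v', u⟫` is bilinear in `v, v'`; the trace lemma replaces one basis at a time. -/
theorem mutualCurvature_eq_sum_frame (h : IsOrthonormalFrameOn e U) (hx : x ∈ U)
    (hA : IsAdaptedOn e U D A) (hA' : IsAdaptedOn e U D' A') :
    mutualCurvature (D x) (D' x) = ∑ a ∈ A, ∑ b ∈ A', frameSectional e x a b := by
  have ho := h.orthonormal x hx
  have h1 (v : TangentSpace I x) :
      ∑ a, ⟪frameCurvature e x (stdOrthonormalBasis ℝ (D x) a) v v,
        stdOrthonormalBasis ℝ (D x) a⟫_ℝ = ∑ a ∈ A, ⟪frameCurvature e x (e a x) v v, e a x⟫_ℝ :=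
    sum_orthonormalBasis_eq ho (hA x hx) (stdOrthonormalBasis ℝ (D x))
      (LinearMap.mk₂ ℝ (fun u u' ↦ ⟪frameCurvature e x u v v, u'⟫_ℝ)
        (fun u₁ u₂ w ↦ by
          simp only [frameCurvature, inner_add_right, add_smul, Finset.sum_add_distrib,
            inner_add_left])
        (fun c u w ↦ by
          simp only [frameCurvature, inner_smul_right, mul_smul, ← Finset.smul_sum,
            inner_smul_left, conj_trivial, smul_eq_mul])
        (fun u w₁ w₂ ↦ inner_add_right _ _ _) (fun c u w ↦ inner_smul_right _ _ _))
  have h2 (u : TangentSpace I x) :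
      ∑ b, ⟪frameCurvature e x u (stdOrthonormalBasis ℝ (D' x) b)
        (stdOrthonormalBasis ℝ (D' x) b), u⟫_ℝ =
        ∑ b ∈ A', ⟪frameCurvature e x u (e b x) (e b x), u⟫_ℝ :=
    sum_orthonormalBasis_eq ho (hA' x hx) (stdOrthonormalBasis ℝ (D' x))
      (LinearMap.mk₂ ℝ (fun v v' ↦ ⟪frameCurvature e x u v v', u⟫_ℝ)
        (fun v₁ v₂ w ↦ by
          simp only [frameCurvature, inner_add_right, add_smul, Finset.sum_add_distrib,
            smul_add, inner_add_left])
        (fun c v w ↦ by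
          simp only [frameCurvature, inner_smul_right, mul_smul, smul_comm _ c, ← Finset.smul_sum,
            inner_smul_left, conj_trivial, smul_eq_mul])
        (fun v w₁ w₂ ↦ by
          simp only [frameCurvature, inner_add_right, add_smul, Finset.sum_add_distrib,
            smul_add, inner_add_left])
        (fun c v w ↦ by
          simp only [frameCurvature, inner_smul_right, mul_smul, smul_comm _ c, ← Finset.smul_sum,
            inner_smul_left, conj_trivial, smul_eq_mul]))
  simp only [mutualCurvature, sectional_eq_frameCurvature h hx]
  rw [Finset.sum_comm]
  simp only [h1]
  rw [Finset.sum_comm]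
  simp only [h2, frameCurvature_frame h hx]
  rfl

/-- Metric compatibility turns each iterated derivative into a derivative of a coefficient minus an
inner product of first derivatives. The last sum comes from expanding the bracket, by vanishing
torsion, in the frame. -/
theorem frameSectional_eq (h : IsOrthonormalFrameOn e U) (hx : x ∈ U) (p q : ι) :
    frameSectional e x p q = mvfderiv I (connCoeff e q q p) x (e p x)
      + mvfderiv I (connCoeff e p p q) x (e q x)
      + (-∑ r, connCoeff e q q r x * connCoeff e p p r x
        + ∑ r, connCoeff e p q r x * connCoeff e q p r x
        - ∑ r, (connCoeff e p q r x - connCoeff e q p r x) * connCoeff e r q p x) := by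
  have hm {X : (x : M) → TangentSpace I x} (hX : SmoothFieldOn U X) : MDiffAt (T% X) x :=
    hX.mdiffAt h.isOpen hx
  have hn (p q) := h.smooth_nabla (h.smooth p) (h.smooth q)
  have d1 : mvfderiv I (connCoeff e q q p) x (e p x) =
      ⟪nabla (e p) (nabla (e q) (e q)) x, e p x⟫_ℝ
        + ⟪nabla (e q) (e q) x, nabla (e p) (e p) x⟫_ℝ :=
    mvfderiv_inner (h.mdiffAt hx p) (hm (hn q q)) (h.mdiffAt hx p)
  have d2 : mvfderiv I (connCoeff e p q p) x (e q x) =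
      ⟪nabla (e q) (nabla (e p) (e q)) x, e p x⟫_ℝ
        + ⟪nabla (e p) (e q) x, nabla (e q) (e p) x⟫_ℝ :=
    mvfderiv_inner (h.mdiffAt hx q) (hm (hn p q)) (h.mdiffAt hx p)
  have d3 : mvfderiv I (connCoeff e p q p) x (e q x) = - mvfderiv I (connCoeff e p p q) x (e q x) := by
    rw [mvfderiv_congr_of_eventuallyEq (g := fun y ↦ -connCoeff e p p q y)
      (Filter.eventually_of_mem (h.isOpen.mem_nhds hx) fun y hy ↦ connCoeff_antisymm h hy p q p),
      mvfderiv_fun_neg]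
    rfl
  have d4 : ⟪nabla (mlieBracket I (e p) (e q)) (e q) x, e p x⟫_ℝ =
      ∑ r, (connCoeff e p q r x - connCoeff e q p r x) * connCoeff e r q p x := by
    rw [← covDeriv_apply (hm ((h.smooth p).mlieBracket (h.smooth q) h.isOpen)) (h.mdiffAt hx q),
      ← nabla_sub_nabla (h.mdiffAt hx p) (h.mdiffAt hx q),
      ← h.sum_inner_smul hx (nabla (e p) (e q) x - nabla (e q) (e p) x), map_sum, sum_inner]
    refine Finset.sum_congr rfl fun r _ ↦ ?_
    rw [map_smul, covDeriv_apply (h.mdiffAt hx r) (h.mdiffAt hx q), inner_smul_left,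
      real_inner_comm, inner_sub_left, conj_trivial]
    rfl
  have s (p q p' q') : ∑ r, connCoeff e p q r x * connCoeff e p' q' r x =
      ⟪nabla (e p) (e q) x, nabla (e p') (e q') x⟫_ℝ :=
    h.sum_inner_mul_inner hx _ _
  rw [s, s, ← d4, frameSectional, curvature, inner_sub_left, inner_sub_left]
  linarith

/-- Read off from the frame formula, which is symmetric in `p` and `q` once `Γ r p q = -Γ r q p` is
used; neither the Bianchi identity nor pair symmetry of the curvature is needed. -/
theorem frameSectional_comm (h : IsOrthonormalFrameOn e U) (hx : x ∈ U) (p q : ι) :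
    frameSectional e x p q = frameSectional e x q p := by
  rw [frameSectional_eq h hx, frameSectional_eq h hx]
  have h3 : ∑ r, (connCoeff e q p r x - connCoeff e p q r x) * connCoeff e r p q x =
      ∑ r, (connCoeff e p q r x - connCoeff e q p r x) * connCoeff e r q p x :=
    Finset.sum_congr rfl fun r _ ↦ by rw [connCoeff_antisymm h hx r p q]; ring
  rw [h3]
  simp only [mul_comm (connCoeff e p p _ x), mul_comm (connCoeff e q p _ x)]
  ring

/-- Walczak's formula for a distribution and its orthogonal complement. -/
theorem IsAdaptedOn.sum_frameSectional (hA : IsAdaptedOn e U D A) (h : IsOrthonormalFrameOn e U)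
    (hx : x ∈ U) : ∑ a ∈ A, ∑ i ∈ Aᶜ, frameSectional e x a i =
      divergence (meanCurvature D) x + divergence (meanCurvature (perp D)) x - Q D x := by
  have hP := hA.orthogonal h
  have hQ : Q D x = (normSqSecondFF D x - normSqIntegrability D x)
      + (normSqSecondFF (perp D) x - normSqIntegrability (perp D) x)
      - ‖meanCurvature D x‖ ^ 2 - ‖meanCurvature (perp D) x‖ ^ 2 := by
    rw [Q]; ring
  rw [hQ, hA.normSq_sub_normSq h hx, hP.normSq_sub_normSq h hx, hA.norm_sq_meanCurvature h hx,
    hP.norm_sq_meanCurvature h hx, hA.divergence_meanCurvature h hx,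
    hP.divergence_meanCurvature h hx, compl_compl]
  simp only [frameSectional_eq h hx]
  -- The derivatives from `div H` occur in the opposite order of summation; those from `div H^⊥`
  -- already match.
  have hder : ∑ a ∈ A, ∑ i ∈ Aᶜ, mvfderiv I (connCoeff e a a i) x (e i x) =
      ∑ i ∈ Aᶜ, ∑ a ∈ A, mvfderiv I (connCoeff e a a i) x (e i x) := Finset.sum_comm
  have key := sum_curvature_quadratic_eq (γ := fun p q r ↦ connCoeff e p q r x)
    (connCoeff_antisymm h hx) A
  simp only [Finset.sum_add_distrib (s := A), Finset.sum_add_distrib (s := Aᶜ)] at key ⊢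
  simp only [Finset.sum_sub_distrib, Finset.sum_neg_distrib, Finset.sum_add_distrib] at key ⊢
  linarith

end Walczak
-- From Walczak's formula to three distributions
section AlmostThreeProduct

variable {E : Type*} [NormedAddCommGroup E] [NormedSpace ℝ E] [FiniteDimensional ℝ E]
  {H : Type*} [TopologicalSpace H] {I : ModelWithCorners ℝ E H}
  {M : Type*} [TopologicalSpace M] [ChartedSpace H M] [IsManifold I ∞ M]
  [RiemannianBundle (fun x : M ↦ TangentSpace I x)]
  [IsContMDiffRiemannianBundle I ∞ E (fun x : M ↦ TangentSpace I x)]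
  {D : Fin 3 → (x : M) → Submodule ℝ (TangentSpace I x)} {n : Fin 3 → ℕ}

theorem IsAlmostThreeProduct.mutualCurvature_comm (hD : IsAlmostThreeProduct D n) (x : M)
    (i j : Fin 3) : mutualCurvature (D i x) (D j x) = mutualCurvature (D j x) (D i x) := by
  obtain ⟨U, hx, e, h, hA⟩ := hD.exists_adapted_frame x
  rw [mutualCurvature_eq_sum_frame h hx (hA i) (hA j),
    mutualCurvature_eq_sum_frame h hx (hA j) (hA i), Finset.sum_comm]
  exact Finset.sum_congr rfl fun a _ ↦ Finset.sum_congr rfl fun b _ ↦ frameSectional_comm h hx b a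

theorem IsAlmostThreeProduct.sum_mutualCurvature (hD : IsAlmostThreeProduct D n) (x : M)
    (i : Fin 3) : ∑ j ∈ {i}ᶜ, mutualCurvature (D i x) (D j x) =
      divergence (meanCurvature (D i)) x + divergence (meanCurvature (perp (D i))) x
        - Q (D i) x := by
  obtain ⟨U, hx, e, h, hA⟩ := hD.exists_adapted_frame x
  rw [← (hA i).sum_frameSectional h hx]
  simp only [mutualCurvature_eq_sum_frame h hx (hA i) (hA _)]
  rw [Finset.sum_comm]
  refine Finset.sum_congr rfl fun a _ ↦ ?_
  -- The indices outside `D i` are grouped by the distribution to which they belong.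
  rw [← Finset.sum_fiberwise_of_maps_to (s := ({p | p.1 = i} : Finset (Σ i, Fin (n i)))ᶜ)
    (g := Sigma.fst) (t := {i}ᶜ) (fun p hp ↦ by simpa using hp)]
  refine Finset.sum_congr rfl fun j hj ↦ Finset.sum_congr ?_ fun _ _ ↦ rfl
  ext p
  have hj' : j ≠ i := by simpa using hj
  simp only [Finset.mem_filter, Finset.mem_univ, true_and, Finset.mem_compl]
  exact ⟨fun hp ↦ ⟨hp ▸ hj', hp⟩, fun hp ↦ hp.2⟩

theorem IsAlmostThreeProduct.mdiffAt_meanCurvature (hD : IsAlmostThreeProduct D n) (x : M)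
    (i : Fin 3) : MDiffAt (T% (meanCurvature (D i))) x ∧
      MDiffAt (T% (meanCurvature (perp (D i)))) x := by
  obtain ⟨U, hx, e, h, hA⟩ := hD.exists_adapted_frame x
  exact ⟨((hA i).smoothFieldOn_meanCurvature h).mdiffAt h.isOpen hx,
    (((hA i).orthogonal h).smoothFieldOn_meanCurvature h).mdiffAt h.isOpen hx⟩

end AlmostThreeProduct

end AlmostProduct

open AlmostProduct in
theorem lemma1 {E : Type*} [NormedAddCommGroup E] [NormedSpace ℝ E] [FiniteDimensional ℝ E]
    {M : Type*} [TopologicalSpace M] [ChartedSpace E M] [IsManifold 𝓘(ℝ, E) ∞ M]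
    [RiemannianBundle (fun x : M ↦ TangentSpace 𝓘(ℝ, E) x)]
    [IsContMDiffRiemannianBundle 𝓘(ℝ, E) ∞ E (fun x : M ↦ TangentSpace 𝓘(ℝ, E) x)]
    (D : Fin 3 → (x : M) → Submodule ℝ (TangentSpace 𝓘(ℝ, E) x)) (n : Fin 3 → ℕ)
    (hD : IsAlmostThreeProduct D n) (x : M) :
    2 * mixedScalarCurvature D x =
        divergence (meanCurvature (D 0) + meanCurvature (perp (D 0))
          + meanCurvature (D 1) + meanCurvature (perp (D 1))
          + meanCurvature (D 2) + meanCurvature (perp (D 2))) x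
        - Q (D 0) x - Q (D 1) x - Q (D 2) x ∧
    2 * mutualCurvature (D 0 x) (D 1 x) =
        divergence (meanCurvature (D 0) + meanCurvature (perp (D 0))
          + meanCurvature (D 1) + meanCurvature (perp (D 1))
          - meanCurvature (D 2) - meanCurvature (perp (D 2))) x
        - Q (D 0) x - Q (D 1) x + Q (D 2) x := by
  obtain ⟨m0, p0⟩ := hD.mdiffAt_meanCurvature x 0
  obtain ⟨m1, p1⟩ := hD.mdiffAt_meanCurvature x 1
  obtain ⟨m2, p2⟩ := hD.mdiffAt_meanCurvature x 2
  have s0 := mdifferentiableAt_add_section m0 p0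
  have s1 := mdifferentiableAt_add_section s0 m1
  have s2 := mdifferentiableAt_add_section s1 p1
  have w0 := hD.sum_mutualCurvature x 0
  have w1 := hD.sum_mutualCurvature x 1
  have w2 := hD.sum_mutualCurvature x 2
  have c0 : ({0}ᶜ : Finset (Fin 3)) = {1, 2} := by decide
  have c1 : ({1}ᶜ : Finset (Fin 3)) = {0, 2} := by decide
  have c2 : ({2}ᶜ : Finset (Fin 3)) = {0, 1} := by decide
  rw [c0, Finset.sum_pair (by decide)] at w0
  rw [c1, Finset.sum_pair (by decide)] at w1
  rw [c2, Finset.sum_pair (by decide)] at w2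
  have k01 := hD.mutualCurvature_comm x 0 1
  have k02 := hD.mutualCurvature_comm x 0 2
  have k12 := hD.mutualCurvature_comm x 1 2
  have hmix : mixedScalarCurvature D x = mutualCurvature (D 0 x) (D 1 x)
      + mutualCurvature (D 0 x) (D 2 x) + mutualCurvature (D 1 x) (D 2 x) := by
    simp [mixedScalarCurvature, Fin.sum_univ_three]
  constructor
  -- The combination is `w0 + w1 + w2`, in which each pair occurs twice.
  · rw [divergence_add (mdifferentiableAt_add_section s2 m2) p2, divergence_add s2 m2,
      divergence_add s1 p1, divergence_add s0 m1, divergence_add m0 p0, hmix]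
    linarith
  -- The combination is `w0 + w1 - w2`: the pairs containing `D 2` cancel.
  · rw [divergence_sub (mdifferentiableAt_sub_section s2 m2) p2, divergence_sub s2 m2,
      divergence_add s1 p1, divergence_add s0 m1, divergence_add m0 p0]
    linarith
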